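/- Let $X\subseteq\{1,\dots,k\}^{\mathbb N}$ be a one-sided subshift (closed, $\sigma(X)\subseteq X$) with language $B(X)$ having the weak specification property: there is $p$ such that for all $u,v\in B(X)$ there is $w\in B(X)$ of length at most $p$ with $uwv\in B(X)$. Let $M(X,\sigma)$ be the set of $\sigma$-invariant Borel probability measures on $X$, let $[x_1\dots x_n]$ denote cylinder sets in $X$, and let $h_m$ denote the Kolmogorov–Sinai entropy. Let $\mathcal F=\{\log f_n\}_{n\ge1}$ with $f_n:X\to(0,\infty)$ continuous. $\mathcal F$ is *weakly almost additive* if there are $C_n>0$ with $C_n/n\to0$ such that $e^{-C_n}f_n(x)f_m(\sigma^n x)\le f_{n+m}(x)\le e^{C_n}f_n(x)f_m(\sigma^n x)$ for all $x\in X$ and $n,m\ge1$, and *almost additive* if $C_n=C$ can be taken constant. A measure $\mu\in M(X,\sigma)$ is an (invariant) *weak Gibbs measure* for $\mathcal F$ if there are $P\in\mathbb R$ and $C_n>0$ with $\frac1n\log C_n\to0$ such that $C_n^{-1}\le \mu[x_1\dots x_n]/(e^{-nP}f_n(x))\le C_n$ for all $x\in X$, $n\ge1$, and a *Gibbs measure*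 if $C_n=C$ can be taken constant. It is an *equilibrium state* for $\mathcal F$ if $\lim_n\frac1n\int\log f_n\,dm$ exists for all $m\in M(X,\sigma)$ and $h_m+\lim_n\frac1n\int\log f_n\,dm$ attains its supremum over $m\in M(X,\sigma)$ at $m=\mu$. For a bounded Borel function $g$ on $X$ the (weak) Gibbs measures are defined with $f_n=e^{S_ng}$, $S_ng=\sum_{i<n}g\circ\sigma^i$, and an equilibrium state is a measure in $M(X,\sigma)$ at which $h_m+\int g\,dm$ attains its supremum over $m\in M(X,\sigma)$. Suppose $\nu\in M(X,\sigma)$ is a Gibbs measure for $\mathcal F$ with constants $P\in\mathbb R$ and $C_0>0$, and that for every $x\in X$ the lower and upper limits, in $[-\infty,\infty]$, of $\log\frac{\nu[x_1\dots x_n]}{\nu[x_2\dots x_n]}$ coincide. Put $r(x)=\lim_{n\to\infty}\log\frac{\nu[x_1\dots x_n]}{\nu[x_2\dots x_n]}+P$. (i) If $\mathcal F$ is almost additive, then $r$ is finite everywhere, bounded and Borel measurable, and for every $\mu\in M(X,\sigma)$ $$\lim_{n\to\infty}\frac1n\int\log f_n\,d\mu=\lim_{n\to\infty}\frac1n\int\log\big(\nu[x_1\dots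 x_n]e^{nP}\big)\,d\mu(x)=\int r\,d\mu .$$ Moreover, $\nu$ is the unique equilibrium state for $\mathcal F$, the unique equilibrium state for $r$, and the unique invariant Gibbs measure for $r$. (ii) If $\mathcal F$ is weakly almost additive, then $r$ is finite everywhere, bounded and Borel measurable, the displayed equalities hold for every $\mu\in M(X,\sigma)$, and $\nu$ is an equilibrium state for $r$ and an invariant weak Gibbs measure for $r$. -/

import Mathlib

open MeasureTheory Filter Topology Set
open SymbolicDynamics.FullShift (Subshift)

noncomputable section

namespace SymbGibbs

/-! ### Measure-theoretic (Kolmogorov-Sinai) entropy -/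

section Entropy

variable {Ω : Type*} [MeasurableSpace Ω]

/-- Shannon entropy `-∑ μ(A) log μ(A)` of the finite partition into the fibres of `α`. -/
def partitionEntropy {ι : Type*} [Fintype ι] (μ : Measure Ω) (α : Ω → ι) : ℝ :=
  ∑ a, Real.negMulLog (μ.real (α ⁻¹' {a}))

/-- The entropy of `T` with respect to the partition `α`, i.e. the limit of `H(α_n) / n`, where
`α_n` is the common refinement of `α, T⁻¹α, …, T⁻⁽ⁿ⁻¹⁾α`. The limit exists by subadditivity
whenever `μ` is a `T`-invariant probability measure, so taking the `limsup` is harmless. -/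
def entropyOfPartition {ι : Type*} [Fintype ι] (T : Ω → Ω) (μ : Measure Ω) (α : Ω → ι) : EReal :=
  limsup (fun n : ℕ =>
    ((partitionEntropy μ (fun x (i : Fin n) => α (T^[i] x)) / n : ℝ) : EReal)) atTop

/-- Kolmogorov-Sinai entropy `h_μ(T)`: the supremum over all finite measurable partitions. -/
def entropy (T : Ω → Ω) (μ : Measure Ω) : EReal :=
  ⨆ (m : ℕ) (α : Ω → Fin m) (_ : Measurable α), entropyOfPartition T μ α

end Entropy

/-! ### Subshifts over `k` symbols

`Subshift (Fin k) ℕ` is the type of closed shift-invariant subsets of `(Fin k)^ℕ`. Coordinates are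
numbered from `0`, so the letters `x₁, x₂, …` of a point are `x 0, x 1, …`. -/

variable {k : ℕ}

/-- The shift map of a subshift. -/
def sigma (X : Subshift (Fin k) ℕ) : X.carrier → X.carrier :=
  (X.mapsTo 1).restrict (SymbolicDynamics.FullShift.shift 1) X.carrier X.carrier

/-- The cylinder `[x₁ … xₙ]` in `X`. -/
def cyl (X : Subshift (Fin k) ℕ) (n : ℕ) (x : X.carrier) : Set X.carrier :=
  {z | ∀ i < n, z.1 i = x.1 i}

/-- The language of `X`: all finite words that appear in points of `X`. -/
def language (X : Subshift (Fin k) ℕ) : Set (List (Fin k)) :=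
  {w | ∃ x ∈ X.carrier, ∃ i : ℕ, ∀ (j : ℕ) (hj : j < w.length), w[j] = x (i + j)}

/-- The weak specification property. -/
def WeakSpecification (X : Subshift (Fin k) ℕ) : Prop :=
  ∃ p : ℕ, ∀ u ∈ language X, ∀ v ∈ language X,
    ∃ w ∈ language X, w.length ≤ p ∧ u ++ w ++ v ∈ language X

/-- The set of shift-invariant Borel probability measures on `X`. -/
def invMeasures (X : Subshift (Fin k) ℕ) : Set (Measure X.carrier) :=
  {μ | IsProbabilityMeasure μ ∧ MeasurePreserving (sigma X) μ μ}

/-! ### Sequences `{log f_n}`, `n ≥ 1`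

A sequence is given by the functions `f n : X → ℝ`; the value of `f 0` is never used. -/

/-- `f n : X → ℝ⁺` is continuous for every `n ≥ 1`. -/
def IsContSeq (X : Subshift (Fin k) ℕ) (f : ℕ → X.carrier → ℝ) : Prop :=
  ∀ n ≥ 1, Continuous (f n) ∧ ∀ x, 0 < f n x

/-- The two inequalities of almost additivity, with constants `C n`. -/
def AdditiveBounds (X : Subshift (Fin k) ℕ) (f : ℕ → X.carrier → ℝ) (C : ℕ → ℝ) : Prop :=
  ∀ n ≥ 1, ∀ m ≥ 1, ∀ x,
    f (n + m) x ≤ Real.exp (C n) * f n x * f m ((sigma X)^[n] x) ∧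
    Real.exp (-C n) * f n x * f m ((sigma X)^[n] x) ≤ f (n + m) x

/-- The sequence `{log f_n}` is almost additive. -/
def AlmostAdditive (X : Subshift (Fin k) ℕ) (f : ℕ → X.carrier → ℝ) : Prop :=
  ∃ C : ℝ, 0 < C ∧ AdditiveBounds X f (fun _ => C)

/-- The sequence `{log f_n}` is weakly almost additive. -/
def WeaklyAlmostAdditive (X : Subshift (Fin k) ℕ) (f : ℕ → X.carrier → ℝ) : Prop :=
  ∃ C : ℕ → ℝ, (∀ n ≥ 1, 0 < C n) ∧ Tendsto (fun n : ℕ => C n / n) atTop (𝓝 0) ∧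
    AdditiveBounds X f C

/-- `1 / C_n ≤ μ[x₁ … xₙ] / (e^{-nP} f_n(x)) ≤ C_n` for all `x` and all `n ≥ 1`. -/
def GibbsBounds (X : Subshift (Fin k) ℕ) (f : ℕ → X.carrier → ℝ) (μ : Measure X.carrier)
    (P : ℝ) (C : ℕ → ℝ) : Prop :=
  ∀ n ≥ 1, ∀ x,
    1 / C n ≤ μ.real (cyl X n x) / (Real.exp (-(n * P)) * f n x) ∧
    μ.real (cyl X n x) / (Real.exp (-(n * P)) * f n x) ≤ C n

/-- `μ` is an invariant Gibbs measure for `{log f_n}`. -/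
def IsGibbs (X : Subshift (Fin k) ℕ) (f : ℕ → X.carrier → ℝ) (μ : Measure X.carrier) : Prop :=
  μ ∈ invMeasures X ∧ ∃ P C : ℝ, 0 < C ∧ GibbsBounds X f μ P (fun _ => C)

/-- `μ` is an invariant weak Gibbs measure for `{log f_n}`. -/
def IsWeakGibbs (X : Subshift (Fin k) ℕ) (f : ℕ → X.carrier → ℝ) (μ : Measure X.carrier) : Prop :=
  μ ∈ invMeasures X ∧ ∃ (P : ℝ) (C : ℕ → ℝ), (∀ n ≥ 1, 0 < C n) ∧
    Tendsto (fun n : ℕ => Real.log (C n) / n) atTop (𝓝 0) ∧ GibbsBounds X f μ P C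

/-- `μ` is an equilibrium state for `{log f_n}`. Here `L m` is the limit of `(1/n) ∫ log f_n dm`;
that it exists for every invariant `m` is part of the definition. -/
def IsEquilibriumSeq (X : Subshift (Fin k) ℕ) (f : ℕ → X.carrier → ℝ)
    (μ : Measure X.carrier) : Prop :=
  μ ∈ invMeasures X ∧ ∃ L : Measure X.carrier → ℝ,
    (∀ m ∈ invMeasures X,
      Tendsto (fun n : ℕ => (1 / n : ℝ) * ∫ x, Real.log (f n x) ∂m) atTop (𝓝 (L m))) ∧
    entropy (sigma X) μ + (L μ : EReal) =
      ⨆ m ∈ invMeasures X, entropy (sigma X) m + (L m : EReal)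

/-! ### Single functions -/

/-- The sequence `e^{S_n g}` attached to a function `g`. -/
def expBirkhoff (X : Subshift (Fin k) ℕ) (g : X.carrier → ℝ) (n : ℕ) (x : X.carrier) : ℝ :=
  Real.exp (birkhoffSum (sigma X) g n x)

/-- `μ` is an equilibrium state for the (bounded Borel) function `g`. -/
def IsEquilibriumFun (X : Subshift (Fin k) ℕ) (g : X.carrier → ℝ)
    (μ : Measure X.carrier) : Prop :=
  μ ∈ invMeasures X ∧
    entropy (sigma X) μ + ((∫ x, g x ∂μ : ℝ) : EReal) =
      ⨆ m ∈ invMeasures X, entropy (sigma X) m + ((∫ x, g x ∂m : ℝ) : EReal)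

/-- `log (ν[x₁ … xₙ₊₁] / ν[x₂ … xₙ₊₁])`. -/
def logRatio (X : Subshift (Fin k) ℕ) (ν : Measure X.carrier) (n : ℕ) (x : X.carrier) : ℝ :=
  Real.log (ν.real (cyl X (n + 1) x) / ν.real (cyl X n (sigma X x)))

/-- `liminf log (ν[x₁ … xₙ] / ν[x₂ … xₙ]) + P`, in the extended reals. -/
def rLower (X : Subshift (Fin k) ℕ) (ν : Measure X.carrier) (P : ℝ) (x : X.carrier) : EReal :=
  liminf (fun n : ℕ => (logRatio X ν n x : EReal)) atTop + (P : EReal)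

/-- `limsup log (ν[x₁ … xₙ] / ν[x₂ … xₙ]) + P`, in the extended reals. -/
def rUpper (X : Subshift (Fin k) ℕ) (ν : Measure X.carrier) (P : ℝ) (x : X.carrier) : EReal :=
  limsup (fun n : ℕ => (logRatio X ν n x : EReal)) atTop + (P : EReal)

/-- `r` is the pointwise (finite) limit of `log (ν[x₁ … xₙ] / ν[x₂ … xₙ]) + P`. -/
def IsLimitPotential (X : Subshift (Fin k) ℕ) (ν : Measure X.carrier) (P : ℝ)
    (r : X.carrier → ℝ) : Prop :=
  ∀ x, Tendsto (fun n : ℕ => logRatio X ν n x + P) atTop (𝓝 (r x))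

/-- For every invariant `μ`, both `(1/n) ∫ log f_n dμ` and `(1/n) ∫ log (ν[x₁ … xₙ] e^{nP}) dμ`
converge to `∫ r dμ`. -/
def IntegralLimits (X : Subshift (Fin k) ℕ) (f : ℕ → X.carrier → ℝ) (ν : Measure X.carrier)
    (P : ℝ) (r : X.carrier → ℝ) : Prop :=
  ∀ μ ∈ invMeasures X,
    Tendsto (fun n : ℕ => (1 / n : ℝ) * ∫ x, Real.log (f n x) ∂μ) atTop (𝓝 (∫ x, r x ∂μ)) ∧
    Tendsto (fun n : ℕ => (1 / n : ℝ) *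
        ∫ x, Real.log (ν.real (cyl X n x) * Real.exp (n * P)) ∂μ) atTop (𝓝 (∫ x, r x ∂μ))

end SymbGibbs

end

/-!
Additivity of `log f` and the Gibbs property make `ν` quasi-Bernoulli, so `log ν[x₁ … xₙ] + nP`
differs from the telescoping sum `S_n r` by at most a sublinear error, which is bounded in the
almost additive case. Integrating against an invariant `μ` gives the limits, and shows that the
relative entropy of `μ` with respect to `ν` on words of length `n` is `n (P - h_μ - ∫ r dμ) +
o(n)`; its positivity is the variational principle. When the error is bounded, an equilibrium state
or Gibbs measure `μ` has bounded relative entropy, respectively bounded density, with respect to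
`ν` on words, so that `μ ≪ ν`. Weak specification lets any two cylinders be joined across a bounded
gap, which together with the quasi-Bernoulli property makes `ν` ergodic, and hence `μ = ν`.
-/

noncomputable section

namespace SymbGibbs

section Partitions

variable {Ω ι κ : Type*}

/-- The atom containing `x` of the partition into the fibres of `F`. -/
def cell (F : Ω → ι) (x : Ω) : Set Ω := F ⁻¹' {F x}

variable [MeasurableSpace Ω] {μ ν : Measure Ω} {F : Ω → ι}

theorem forall_of_ae_comp {p : ι → Prop} (h : ∀ᵐ x ∂μ, p (F x)) {s : ι}
    (hs : μ (F ⁻¹' {s}) ≠ 0) : p s := by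
  contrapose! hs
  refine measure_mono_null (fun x (hx : F x = s) => ?_) h
  simpa [hx] using hs

theorem ae_cell_pos [Finite ι] [IsFiniteMeasure μ] (F : Ω → ι) :
    ∀ᵐ x ∂μ, 0 < μ.real (cell F x) := by
  have hnull : μ (⋃ s ∈ {s | μ (F ⁻¹' {s}) = 0}, F ⁻¹' {s}) = 0 :=
    (measure_biUnion_null_iff (to_countable _)).2 fun _ hs => hs
  refine measure_mono_null (fun x hx => mem_biUnion (x := F x) ?_ rfl) hnull
  exact (measureReal_eq_zero_iff (measure_ne_top μ _)).1
    (measureReal_nonneg.antisymm' (not_lt.1 hx))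

theorem integral_comp_of_measurePreserving {T : Ω → Ω} (hT : MeasurePreserving T μ μ)
    {φ : Ω → ℝ} (hφ : AEStronglyMeasurable φ μ) : ∫ x, φ (T x) ∂μ = ∫ x, φ x ∂μ := by
  rw [← integral_map hT.measurable.aemeasurable (hT.map_eq.symm ▸ hφ), hT.map_eq]

theorem integrable_birkhoffSum {T : Ω → Ω} (hT : MeasurePreserving T μ μ) {φ : Ω → ℝ}
    (hφ : Integrable φ μ) (n : ℕ) : Integrable (birkhoffSum T φ n) μ :=
  integrable_finsetSum _ fun i _ => (hT.iterate i).integrable_comp_of_integrable hφ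

theorem integral_birkhoffSum {T : Ω → Ω} (hT : MeasurePreserving T μ μ) {φ : Ω → ℝ}
    (hφ : Integrable φ μ) (n : ℕ) : ∫ x, birkhoffSum T φ n x ∂μ = n * ∫ x, φ x ∂μ := by
  simp only [birkhoffSum]
  rw [integral_finsetSum (f := fun i x => φ (T^[i] x)) _ fun i _ =>
    (hT.iterate i).integrable_comp_of_integrable hφ]
  simp only [integral_comp_of_measurePreserving (hT.iterate _) hφ.1, Finset.sum_const,
    Finset.card_range, nsmul_eq_mul]

theorem partitionEntropy_nonneg [Fintype ι] [IsProbabilityMeasure μ] (F : Ω → ι) :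
    0 ≤ partitionEntropy μ F :=
  Finset.sum_nonneg fun _ _ => Real.negMulLog_nonneg measureReal_nonneg measureReal_le_one

variable [MeasurableSpace ι] [MeasurableSingletonClass ι]

theorem measurableSet_cell (hF : Measurable F) (x : Ω) : MeasurableSet (cell F x) :=
  hF (measurableSet_singleton _)

theorem measure_preimage_le_of_cell_le [Finite ι] (hF : Measurable F)
    (h : ∀ x, μ (cell F x) ≤ ν (cell F x)) (S : Set ι) : μ (F ⁻¹' S) ≤ ν (F ⁻¹' S) := by
  rw [← S.toFinite.coe_toFinset,
    ← sum_measure_preimage_singleton _ fun s _ => hF (measurableSet_singleton s),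
    ← sum_measure_preimage_singleton _ fun s _ => hF (measurableSet_singleton s)]
  refine Finset.sum_le_sum fun s _ => ?_
  rcases (F ⁻¹' {s}).eq_empty_or_nonempty with he | ⟨x, rfl⟩
  · simp [he]
  · exact h x

theorem integrable_comp_of_finite [Finite ι] [IsFiniteMeasure μ] (hF : Measurable F)
    (φ : ι → ℝ) : Integrable (fun x => φ (F x)) μ :=
  (Integrable.of_finite (μ := μ.map F) (f := φ)).comp_measurable hF

theorem integrable_log_measureReal_cell [Finite ι] [IsFiniteMeasure μ] (ν : Measure Ω)
    (hF : Measurable F) : Integrable (fun x => -Real.log (ν.real (cell F x))) μ :=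
  integrable_comp_of_finite hF fun s => -Real.log (ν.real (F ⁻¹' {s}))

variable [Fintype ι]

theorem integral_comp_fintype [IsFiniteMeasure μ] (hF : Measurable F) (φ : ι → ℝ) :
    ∫ x, φ (F x) ∂μ = ∑ s, μ.real (F ⁻¹' {s}) * φ s := by
  have hφ : Integrable φ (μ.map F) := Integrable.of_finite
  rw [← integral_map hF.aemeasurable hφ.aestronglyMeasurable, integral_fintype hφ]
  simp only [map_measureReal_apply hF (measurableSet_singleton _), smul_eq_mul]

theorem sum_measureReal_fiber [IsProbabilityMeasure μ] (hF : Measurable F) :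
    ∑ s, μ.real (F ⁻¹' {s}) = 1 := by
  simpa using (integral_comp_fintype (μ := μ) hF (fun _ => 1)).symm

theorem partitionEntropy_comp {T : Ω → Ω} (hT : MeasurePreserving T μ μ) (hF : Measurable F) :
    partitionEntropy μ (F ∘ T) = partitionEntropy μ F :=
  Finset.sum_congr rfl fun s _ => congrArg Real.negMulLog <|
    hT.measureReal_preimage (hF (measurableSet_singleton s)).nullMeasurableSet

theorem partitionEntropy_eq_integral [IsFiniteMeasure μ] (hF : Measurable F) :
    partitionEntropy μ F = ∫ x, -Real.log (μ.real (cell F x)) ∂μ :=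
  Eq.symm <| (integral_comp_fintype hF fun s => -Real.log (μ.real (F ⁻¹' {s}))).trans <|
    Finset.sum_congr rfl fun s _ => by rw [Real.negMulLog]; ring

/-- Gibbs' inequality, for weights that need not be normalized. -/
theorem partitionEntropy_le_integral_neg_log [IsProbabilityMeasure μ] (hF : Measurable F)
    {q : ι → ℝ} (hq : ∀ s, 0 ≤ q s) (hpos : ∀ᵐ x ∂μ, 0 < q (F x)) :
    partitionEntropy μ F ≤ ∫ x, -Real.log (q (F x)) ∂μ + (∑ s, q s - 1) := by
  rw [integral_comp_fintype hF (fun s => -Real.log (q s)), ← sum_measureReal_fiber (μ := μ) hF,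
    ← Finset.sum_sub_distrib, ← Finset.sum_add_distrib, partitionEntropy]
  refine Finset.sum_le_sum fun s _ => ?_
  rcases eq_or_ne (μ (F ⁻¹' {s})) 0 with h | h
  · simp [measureReal_def, h, hq s]
  · have hqs : 0 < q s := forall_of_ae_comp (p := fun s => 0 < q s) hpos h
    have hμs : 0 < μ.real (F ⁻¹' {s}) := ENNReal.toReal_pos h (measure_ne_top μ _)
    have hlog := Real.log_le_sub_one_of_pos (div_pos hqs hμs)
    rw [Real.log_div hqs.ne' hμs.ne'] at hlog
    have hmul := mul_le_mul_of_nonneg_left hlog hμs.le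
    rw [mul_sub, mul_sub, mul_div_cancel₀ _ hμs.ne'] at hmul
    rw [Real.negMulLog]
    linarith

variable [Fintype κ] [MeasurableSpace κ] [MeasurableSingletonClass κ]

theorem partitionEntropy_mono [IsFiniteMeasure μ] {G : Ω → κ} (hG : Measurable G)
    (hF : Measurable F) (h : ∀ x, cell F x ⊆ cell G x) :
    partitionEntropy μ G ≤ partitionEntropy μ F := by
  rw [partitionEntropy_eq_integral hG, partitionEntropy_eq_integral hF]
  refine integral_mono_ae (integrable_log_measureReal_cell μ hG)
    (integrable_log_measureReal_cell μ hF) ?_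
  filter_upwards [ae_cell_pos (μ := μ) F] with x hx
  exact neg_le_neg (Real.log_le_log hx (measureReal_mono (h x)))

/-- The conditional entropy of `A` given `S` is at most the expected code length of `A` for any
family of conditional weights `Q`. -/
theorem partitionEntropy_prodMk_le [IsProbabilityMeasure μ] {A : Ω → ι} (hA : Measurable A)
    {S : Ω → κ} (hS : Measurable S) {Q : κ → ι → ℝ} (hQ : ∀ s a, 0 ≤ Q s a)
    (hQ_sum : ∀ s, ∑ a, Q s a ≤ 1) (hpos : ∀ᵐ x ∂μ, 0 < Q (S x) (A x)) :
    partitionEntropy μ (fun x => (A x, S x)) ≤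
      partitionEntropy μ S + ∫ x, -Real.log (Q (S x) (A x)) ∂μ := by
  let q : ι × κ → ℝ := fun s => μ.real (S ⁻¹' {s.2}) * Q s.2 s.1
  have hAS := hA.prodMk hS
  have hcell := ae_cell_pos (μ := μ) S
  have hq_sum : ∑ s, q s ≤ 1 := by
    rw [Fintype.sum_prod_type_right, ← sum_measureReal_fiber (μ := μ) hS]
    refine Finset.sum_le_sum fun s _ => ?_
    simp only [q, ← Finset.mul_sum]
    exact mul_le_of_le_one_right measureReal_nonneg (hQ_sum s)
  have hq_log : ∫ x, -Real.log (q (A x, S x)) ∂μ =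
      partitionEntropy μ S + ∫ x, -Real.log (Q (S x) (A x)) ∂μ := by
    rw [partitionEntropy_eq_integral hS, ← integral_add (integrable_log_measureReal_cell μ hS)
      (integrable_comp_of_finite hAS fun s => -Real.log (Q s.2 s.1))]
    refine integral_congr_ae ?_
    filter_upwards [hcell, hpos] with x hx hx'
    rw [← neg_add, ← Real.log_mul hx.ne' hx'.ne']
    rfl
  have hgibbs := partitionEntropy_le_integral_neg_log (q := q) hAS
    (fun s => mul_nonneg measureReal_nonneg (hQ s.2 s.1))
    (by filter_upwards [hcell, hpos] with x hx hx' using mul_pos hx hx')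
  linarith

theorem partitionEntropy_prodMk_le_add [IsProbabilityMeasure μ] {A : Ω → ι} (hA : Measurable A)
    {S : Ω → κ} (hS : Measurable S) :
    partitionEntropy μ (fun x => (A x, S x)) ≤ partitionEntropy μ S + partitionEntropy μ A := by
  rw [partitionEntropy_eq_integral hA]
  exact partitionEntropy_prodMk_le hA hS (Q := fun _ a => μ.real (A ⁻¹' {a}))
    (fun _ _ => measureReal_nonneg) (fun _ => (sum_measureReal_fiber hA).le) (ae_cell_pos A)

end Partitions

section CrossEntropy

variable {Ω ι : Type*} [MeasurableSpace Ω] [MeasurableSpace ι] [MeasurableSingletonClass ι]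
  {μ ν : Measure Ω} {F : Ω → ι}

/-- The cross entropy `-∑ μ(A) log ν(A)` of the partition into the fibres of `F`. Its excess over
`partitionEntropy μ F` is the relative entropy of `μ` with respect to `ν` on that partition. -/
def crossEntropy (μ ν : Measure Ω) (F : Ω → ι) : ℝ :=
  ∫ x, -Real.log (ν.real (cell F x)) ∂μ

theorem crossEntropy_self [Fintype ι] [IsFiniteMeasure μ] (hF : Measurable F) :
    crossEntropy μ μ F = partitionEntropy μ F :=
  (partitionEntropy_eq_integral hF).symm

variable [Fintype ι] [IsProbabilityMeasure μ] [IsProbabilityMeasure ν]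

/-- The Donsker–Varadhan inequality on a finite partition. -/
theorem integral_comp_le_crossEntropy_sub (hF : Measurable F)
    (hν : ∀ᵐ x ∂μ, 0 < ν.real (cell F x)) (φ : ι → ℝ) :
    ∫ x, φ (F x) ∂μ ≤
      crossEntropy μ ν F - partitionEntropy μ F + (∫ x, Real.exp (φ (F x)) ∂ν - 1) := by
  have hlog : ∫ x, -Real.log (ν.real (cell F x) * Real.exp (φ (F x))) ∂μ =
      crossEntropy μ ν F - ∫ x, φ (F x) ∂μ := by
    rw [crossEntropy, ← integral_sub (integrable_log_measureReal_cell ν hF)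
      (integrable_comp_of_finite hF φ)]
    refine integral_congr_ae ?_
    filter_upwards [hν] with x hx
    rw [Real.log_mul hx.ne' (Real.exp_ne_zero _), Real.log_exp, neg_add']
  have hgibbs := partitionEntropy_le_integral_neg_log (μ := μ) hF
    (q := fun s => ν.real (F ⁻¹' {s}) * Real.exp (φ s)) (fun s => by positivity)
    (by filter_upwards [hν] with x hx using mul_pos hx (Real.exp_pos _))
  rw [← integral_comp_fintype hF fun s => Real.exp (φ s)] at hgibbs
  simp only [cell] at hlog
  linarith

theorem partitionEntropy_le_crossEntropy (hF : Measurable F)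
    (hν : ∀ᵐ x ∂μ, 0 < ν.real (cell F x)) : partitionEntropy μ F ≤ crossEntropy μ ν F := by
  simpa using integral_comp_le_crossEntropy_sub hF hν 0

theorem mul_measureReal_preimage_le_crossEntropy_sub (hF : Measurable F)
    (hν : ∀ᵐ x ∂μ, 0 < ν.real (cell F x)) (S : Set ι) (c : ℝ) :
    c * μ.real (F ⁻¹' S) ≤ crossEntropy μ ν F - partitionEntropy μ F +
      (Real.exp c - 1) * ν.real (F ⁻¹' S) := by
  have hS : MeasurableSet (F ⁻¹' S) := hF S.toFinite.measurableSet
  have hind (c : ℝ) (ρ : Measure Ω) :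
      ∫ x, S.indicator (fun _ => c) (F x) ∂ρ = c * ρ.real (F ⁻¹' S) := by
    rw [mul_comm, ← smul_eq_mul, ← integral_indicator_const c hS]
    rfl
  have hexp (s : ι) : Real.exp (S.indicator (fun _ => c) s) =
      S.indicator (fun _ => Real.exp c - 1) s + 1 := by
    by_cases hs : s ∈ S <;> simp [hs]
  have h := integral_comp_le_crossEntropy_sub hF hν (S.indicator fun _ => c)
  simp only [hexp] at h
  rw [integral_add (integrable_comp_of_finite hF _) (integrable_const 1), hind, hind] at h
  simpa using h

end CrossEntropy

section GeneratingSequence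

open scoped symmDiff NNReal

variable {Ω : Type*} [mΩ : MeasurableSpace Ω] {ι : ℕ → Type*} [∀ n, MeasurableSpace (ι n)]
  {F : ∀ n, Ω → ι n}

/-- A sequence of measurable partitions, given by the fibres of the maps `F n`, each refining the
previous ones and together generating the `σ`-algebra. -/
structure IsGeneratingSequence (F : ∀ n, Ω → ι n) : Prop where
  measurable : ∀ n, Measurable (F n)
  cell_anti : ∀ x, Antitone fun n => cell (F n) x
  generateFrom_eq : mΩ = MeasurableSpace.generateFrom {B | ∃ n S, F n ⁻¹' S = B}

namespace IsGeneratingSequence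

theorem exists_preimage_eq (hF : IsGeneratingSequence F) {m n : ℕ} (hmn : m ≤ n)
    (S : Set (ι m)) : ∃ S', F n ⁻¹' S' = F m ⁻¹' S := by
  refine ⟨F n '' (F m ⁻¹' S), subset_antisymm ?_ (subset_preimage_image _ _)⟩
  rintro x ⟨y, hy, hyx⟩
  have hx : F m x = F m y := hF.cell_anti y hmn hyx.symm
  rwa [mem_preimage, hx]

theorem isSetRing (hF : IsGeneratingSequence F) : IsSetRing {B | ∃ n S, F n ⁻¹' S = B} where
  empty_mem := ⟨0, ∅, rfl⟩
  union_mem := by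
    rintro _ _ ⟨n, S, rfl⟩ ⟨m, R, rfl⟩
    obtain ⟨S', hS'⟩ := hF.exists_preimage_eq (le_max_left n m) S
    obtain ⟨R', hR'⟩ := hF.exists_preimage_eq (le_max_right n m) R
    exact ⟨max n m, S' ∪ R', by rw [preimage_union, hS', hR']⟩
  sdiff_mem := by
    rintro _ _ ⟨n, S, rfl⟩ ⟨m, R, rfl⟩
    obtain ⟨S', hS'⟩ := hF.exists_preimage_eq (le_max_left n m) S
    obtain ⟨R', hR'⟩ := hF.exists_preimage_eq (le_max_right n m) R
    exact ⟨max n m, S' \ R', by rw [preimage_sdiff, hS', hR']⟩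

section Finite

variable [∀ n, Finite (ι n)]

theorem exists_tendsto_measure_symmDiff (hF : IsGeneratingSequence F) (μ : Measure Ω)
    [IsFiniteMeasure μ] {B : Set Ω} (hB : MeasurableSet B) :
    ∃ S : ∀ n, Set (ι n), Tendsto (fun n => μ ((F n ⁻¹' S n) ∆ B)) atTop (𝓝 0) := by
  choose S hS using fun n => Finite.exists_min fun S : Set (ι n) => μ ((F n ⁻¹' S) ∆ B)
  refine ⟨S, ENNReal.tendsto_nhds_zero.2 fun ε hε => ?_⟩
  obtain ⟨_, ⟨m, R, rfl⟩, hR⟩ := exists_measure_symmDiff_lt_of_generateFrom_isSetRing (μ := μ)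
    hF.isSetRing ⟨{univ}, countable_singleton _,
      singleton_subset_iff.2 ⟨0, univ, preimage_univ⟩, by simp⟩
    hF.generateFrom_eq hB hε
  filter_upwards [eventually_ge_atTop m] with n hn
  obtain ⟨R', hR'⟩ := hF.exists_preimage_eq hn R
  exact (hS n R').trans (hR' ▸ hR.le)

theorem exists_map_measureReal_ne_le (hF : IsGeneratingSequence F) {κ : Type*} [Finite κ]
    [MeasurableSpace κ] [MeasurableSingletonClass κ] [Nonempty κ] (μ : Measure Ω)
    [IsFiniteMeasure μ] {β : Ω → κ} (hβ : Measurable β) {ε : ℝ} (hε : 0 < ε) :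
    ∃ (n : ℕ) (g : ι n → κ), μ.real {x | β x ≠ g (F n x)} ≤ ε := by
  classical
  have := Fintype.ofFinite κ
  choose S hS using fun a : κ =>
    hF.exists_tendsto_measure_symmDiff μ (hβ (measurableSet_singleton a))
  have hsum : Tendsto (fun n => ∑ a, μ ((F n ⁻¹' S a n) ∆ (β ⁻¹' {a}))) atTop (𝓝 0) := by
    simpa using tendsto_finsetSum Finset.univ fun a _ => hS a
  obtain ⟨n, hn⟩ := (hsum.eventually (gt_mem_nhds (ENNReal.ofReal_pos.2 hε))).exists
  refine ⟨n, fun s => Classical.epsilon fun a => s ∈ S a n, ?_⟩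
  refine ENNReal.toReal_le_of_le_ofReal hε.le (le_trans ?_ hn.le)
  refine (measure_mono fun x hx => ?_).trans (measure_iUnion_fintype_le _ _)
  by_contra hx'
  simp only [mem_iUnion, mem_symmDiff, mem_preimage, mem_singleton_iff, not_exists, not_or,
    not_and, not_not] at hx'
  exact hx ((hx' _).1 (Classical.epsilon_spec (p := fun a => F n x ∈ S a n)
    ⟨β x, (hx' (β x)).2 rfl⟩))

variable [∀ n, MeasurableSingletonClass (ι n)]

theorem exists_tendsto_measureReal_preimage (hF : IsGeneratingSequence F) (μ ν : Measure Ω)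
    [IsFiniteMeasure μ] [IsFiniteMeasure ν] {B : Set Ω} (hB : MeasurableSet B) :
    ∃ S : ∀ n, Set (ι n), Tendsto (fun n => μ.real (F n ⁻¹' S n)) atTop (𝓝 (μ.real B)) ∧
      Tendsto (fun n => ν.real (F n ⁻¹' S n)) atTop (𝓝 (ν.real B)) := by
  obtain ⟨S, hS⟩ := hF.exists_tendsto_measure_symmDiff (μ + ν) hB
  have hlim (ρ : Measure Ω) [IsFiniteMeasure ρ] (hρ : ρ ≤ μ + ν) :
      Tendsto (fun n => ρ.real (F n ⁻¹' S n)) atTop (𝓝 (ρ.real B)) := by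
    have hρS : Tendsto (fun n => ρ.real ((F n ⁻¹' S n) ∆ B)) atTop (𝓝 0) :=
      (ENNReal.tendsto_toReal ENNReal.zero_ne_top).comp <|
        tendsto_of_tendsto_of_tendsto_of_le_of_le tendsto_const_nhds hS (fun _ => zero_le)
          fun _ => hρ _
    refine tendsto_iff_dist_tendsto_zero.2 (squeeze_zero (fun _ => dist_nonneg) (fun n => ?_) hρS)
    exact abs_measureReal_sub_le_measureReal_symmDiff
      (hF.measurable n (S n).toFinite.measurableSet).nullMeasurableSet hB.nullMeasurableSet
  exact ⟨S, hlim μ (Measure.le_add_right le_rfl), hlim ν (Measure.le_add_left le_rfl)⟩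

theorem measure_le_of_cell_le (hF : IsGeneratingSequence F) {μ ν : Measure Ω} [IsFiniteMeasure μ]
    [IsFiniteMeasure ν] (h : ∀ᶠ n in atTop, ∀ x, μ (cell (F n) x) ≤ ν (cell (F n) x)) :
    μ ≤ ν := by
  refine Measure.le_intro fun B hB _ => ?_
  obtain ⟨S, hμ, hν⟩ := hF.exists_tendsto_measureReal_preimage μ ν hB
  refine (ENNReal.toReal_le_toReal (measure_ne_top _ _) (measure_ne_top _ _)).1 <|
    le_of_tendsto_of_tendsto hμ hν (h.mono fun n hn => ?_)
  exact ENNReal.toReal_mono (measure_ne_top _ _)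
    (measure_preimage_le_of_cell_le (hF.measurable n) hn (S n))

section Mixing

variable {T : Ω → Ω} {ν : Measure Ω} [IsFiniteMeasure ν] {c : ℝ≥0} {p : ℕ}

theorem mul_measure_cell_mul_le (hF : IsGeneratingSequence F) (hT : Measurable T) {n : ℕ} {x : Ω}
    (hmix : ∀ m y, c * ν (cell (F n) x) * ν (cell (F m) y) ≤
      ∑ l ∈ Finset.range (p + 1), ν (cell (F n) x ∩ T^[n + l] ⁻¹' cell (F m) y))
    {A : Set Ω} (hA : MeasurableSet A) (hTA : T ⁻¹' A = A) :
    c * ν (cell (F n) x) * ν A ≤ (p + 1 : ℕ) * ν (cell (F n) x ∩ A) := by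
  have hmap {B : Set Ω} (hB : MeasurableSet B) (l : ℕ) :
      (ν.restrict (cell (F n) x)).map T^[n + l] B = ν (cell (F n) x ∩ T^[n + l] ⁻¹' B) := by
    rw [Measure.map_apply (hT.iterate _) hB,
      Measure.restrict_apply (hT.iterate _ hB), inter_comm]
  have hfin : IsFiniteMeasure ((c * ν (cell (F n) x)) • ν) := ν.smul_finite (by finiteness)
  have hfin' : IsFiniteMeasure
      (∑ l ∈ Finset.range (p + 1), (ν.restrict (cell (F n) x)).map T^[n + l]) := inferInstance
  have hle : (c * ν (cell (F n) x)) • ν ≤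
      ∑ l ∈ Finset.range (p + 1), (ν.restrict (cell (F n) x)).map T^[n + l] := by
    refine hF.measure_le_of_cell_le (.of_forall fun m y => ?_)
    simpa only [Measure.smul_apply, smul_eq_mul, Measure.finsetSum_apply,
      hmap (measurableSet_cell (hF.measurable m) y)] using hmix m y
  have hiter (i : ℕ) : T^[i] ⁻¹' A = A := by
    rw [preimage_iterate_eq]
    exact Function.iterate_fixed hTA i
  simpa [hmap hA, hiter] using hle A

/-- Any two cells meet under a bounded gap with probability comparable to the product of their
measures. For an invariant set `A` the cells can be replaced, one after the other, by arbitrary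
measurable sets; the choice `A`, `Aᶜ` shows that `A` is trivial. -/
theorem ergodic_of_gap_mixing (hF : IsGeneratingSequence F) (hT : MeasurePreserving T ν ν)
    (hc : c ≠ 0)
    (hmix : ∀ n m x y, c * ν (cell (F n) x) * ν (cell (F m) y) ≤
      ∑ l ∈ Finset.range (p + 1), ν (cell (F n) x ∩ T^[n + l] ⁻¹' cell (F m) y)) :
    Ergodic T ν := by
  refine ⟨hT, ⟨fun A hA hTA => ?_⟩⟩
  have hfin : IsFiniteMeasure ((c * ν A) • ν) := ν.smul_finite (by finiteness)
  have hfin' : IsFiniteMeasure (((p + 1 : ℕ) : ENNReal) • ν.restrict A) :=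
    (ν.restrict A).smul_finite (by finiteness)
  have hle : (c * ν A) • ν ≤ ((p + 1 : ℕ) : ENNReal) • ν.restrict A := by
    refine hF.measure_le_of_cell_le (.of_forall fun n x => ?_)
    rw [Measure.smul_apply, Measure.smul_apply, smul_eq_mul, smul_eq_mul,
      Measure.restrict_apply' hA, mul_right_comm]
    exact hF.mul_measure_cell_mul_le hT.measurable (hmix n · x) hA hTA
  have hnull : ν A = 0 ∨ ν Aᶜ = 0 := by
    simpa [hc, Measure.restrict_apply' hA] using hle Aᶜ
  rw [eventuallyConst_set']
  exact hnull.imp ae_eq_empty.2 ae_eq_univ.2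

end Mixing

end Finite

/-- A uniform bound on the relative entropies of `μ` with respect to `ν` along a generating
sequence forces `μ ≪ ν`: by the Donsker–Varadhan inequality a `ν`-small set `S` has
`c * μ S ≤ K + (exp c - 1) * ν S` for every `c`. -/
theorem absolutelyContinuous_of_crossEntropy_sub_le [∀ n, Fintype (ι n)]
    [∀ n, MeasurableSingletonClass (ι n)] (hF : IsGeneratingSequence F) {μ ν : Measure Ω}
    [IsProbabilityMeasure μ] [IsProbabilityMeasure ν] {K : ℝ}
    (hν : ∀ n, ∀ᵐ x ∂μ, 0 < ν.real (cell (F n) x))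
    (hK : ∀ᶠ n in atTop, crossEntropy μ ν (F n) - partitionEntropy μ (F n) ≤ K) : μ ≪ ν := by
  refine Measure.AbsolutelyContinuous.mk fun B hB hνB => ?_
  obtain ⟨S, hμS, hνS⟩ := hF.exists_tendsto_measureReal_preimage μ ν hB
  rw [measureReal_def, hνB, ENNReal.toReal_zero] at hνS
  have hbound (c : ℝ) : c * μ.real B ≤ K := by
    have hlim := (hνS.const_mul (Real.exp c - 1)).const_add K
    rw [mul_zero, add_zero] at hlim
    refine le_of_tendsto_of_tendsto (hμS.const_mul c) hlim (hK.mono fun n hn => ?_)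
    have := mul_measureReal_preimage_le_crossEntropy_sub (hF.measurable n) (hν n) (S n) c
    linarith
  by_contra hμB
  have hpos : 0 < μ.real B := ENNReal.toReal_pos hμB (measure_ne_top _ _)
  have := hbound ((K + 1) / μ.real B)
  rw [div_mul_cancel₀ _ hpos.ne'] at this
  linarith

end IsGeneratingSequence

end GeneratingSequence

section EntropyRate

variable {Ω ι κ : Type*} {T : Ω → Ω} {α : Ω → ι} {β : Ω → κ}

/-- The itinerary of length `n` of a point with respect to the partition into the fibres of `α`. -/
def itinerary (T : Ω → Ω) (α : Ω → ι) (n : ℕ) (x : Ω) : Fin n → ι :=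
  fun i => α (T^[i] x)

theorem mem_cell_itinerary {n : ℕ} {x z : Ω} :
    z ∈ cell (itinerary T α n) x ↔ ∀ i < n, α (T^[i] z) = α (T^[i] x) := by
  simp only [cell, mem_preimage, mem_singleton_iff, funext_iff, itinerary, Fin.forall_iff]

theorem cell_itinerary_anti (x : Ω) : Antitone fun n => cell (itinerary T α n) x :=
  fun _ _ hmn _ hz => mem_cell_itinerary.2 fun i hi => mem_cell_itinerary.1 hz i (hi.trans_le hmn)

/-- The limit of `H(α_n) / n`, where `α_n` is the partition according to itineraries of length `n`;
by Fekete's lemma it is an infimum. -/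
def entropyRate [MeasurableSpace Ω] [Fintype ι] (T : Ω → Ω) (μ : Measure Ω) (α : Ω → ι) : ℝ :=
  sInf ((fun n : ℕ => partitionEntropy μ (itinerary T α n) / n) '' Ici 1)

theorem bddBelow_partitionEntropy_itinerary_div [MeasurableSpace Ω] [Fintype ι] (T : Ω → Ω)
    (μ : Measure Ω) [IsProbabilityMeasure μ] (α : Ω → ι) :
    BddBelow (range fun n : ℕ => partitionEntropy μ (itinerary T α n) / n) :=
  ⟨0, forall_mem_range.2 fun n => div_nonneg (partitionEntropy_nonneg _) n.cast_nonneg⟩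

variable [MeasurableSpace Ω] [MeasurableSpace ι]

theorem measurable_itinerary (hT : Measurable T) (hα : Measurable α) (n : ℕ) :
    Measurable (itinerary T α n) :=
  measurable_pi_lambda _ fun i => hα.comp (hT.iterate i)

variable {μ : Measure Ω} [IsProbabilityMeasure μ] [MeasurableSingletonClass ι]

/-- Weights that predict `β` by `g ∘ S`: most of the mass sits on the predicted value, the rest is
spread evenly. -/
theorem exists_weights_integral_le [Finite ι] [Fintype κ] [Nonempty κ] [MeasurableSpace κ]
    [MeasurableSingletonClass κ] {S : Ω → ι} (hS : Measurable S) (hβ : Measurable β)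
    {c : ℝ} (hc : 0 < c) (g : ι → κ) :
    ∃ q : ι → κ → ℝ, (∀ s b, 0 < q s b) ∧ (∀ s, ∑ b, q s b ≤ 1) ∧
      ∫ x, -Real.log (q (S x) (β x)) ∂μ ≤
        c + μ.real {x | β x ≠ g (S x)} * |Real.log ((1 - Real.exp (-c)) / Fintype.card κ)| := by
  classical
  have hexp : 0 < 1 - Real.exp (-c) := by simpa using hc
  set δ := (1 - Real.exp (-c)) / Fintype.card κ with hδ_def
  have hδ : 0 < δ := by positivity
  let q (s : ι) (b : κ) : ℝ := if b = g s then Real.exp (-c) else δ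
  refine ⟨q, fun s b => by simp only [q]; split_ifs <;> positivity, fun s => ?_, ?_⟩
  · calc ∑ b, q s b ≤ ∑ b, ((if b = g s then Real.exp (-c) else 0) + δ) := by
          refine Finset.sum_le_sum fun b _ => ?_
          simp only [q]
          split_ifs <;> linarith
      _ = 1 := by
          rw [Finset.sum_add_distrib, Finset.sum_ite_eq' Finset.univ, hδ_def]
          simp
          field_simp
          ring
  · have hE : MeasurableSet {x | β x ≠ g (S x)} :=
      (measurableSet_eq_fun hβ ((measurable_of_finite g).comp hS)).compl
    have hint := (integrable_const (μ := μ) |Real.log δ|).indicator hE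
    calc ∫ x, -Real.log (q (S x) (β x)) ∂μ
        ≤ ∫ x, (c + {x | β x ≠ g (S x)}.indicator (fun _ => |Real.log δ|) x) ∂μ := by
          refine integral_mono
            (integrable_comp_of_finite (hS.prodMk hβ) fun p => -Real.log (q p.1 p.2))
            ((integrable_const c).add hint) fun x => ?_
          by_cases h : β x = g (S x)
          · simp [q, h]
          · simpa [q, h] using (neg_le_abs _).trans (le_add_of_nonneg_left hc.le)
      _ = c + μ.real {x | β x ≠ g (S x)} * |Real.log δ| := by
          rw [integral_add (integrable_const c) hint, integral_indicator_const _ hE]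
          simp

variable [Fintype ι]

theorem subadditive_partitionEntropy_itinerary (hT : MeasurePreserving T μ μ)
    (hα : Measurable α) : Subadditive fun n => partitionEntropy μ (itinerary T α n) := by
  intro m n
  have hm := measurable_itinerary hT.measurable hα m
  have hn := measurable_itinerary hT.measurable hα n
  have hnm := hn.comp (hT.measurable.iterate m)
  calc partitionEntropy μ (itinerary T α (m + n))
      ≤ partitionEntropy μ fun x => (itinerary T α m x, (itinerary T α n ∘ T^[m]) x) := by
        refine partitionEntropy_mono (measurable_itinerary hT.measurable hα _) (hm.prodMk hnm)
          fun x z hz => mem_cell_itinerary.2 fun i hi => ?_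
        obtain ⟨hzm, hzn⟩ := Prod.mk.inj hz
        rcases lt_or_ge i m with him | him
        · exact mem_cell_itinerary.1 hzm i him
        · obtain ⟨j, rfl⟩ := Nat.exists_eq_add_of_le' him
          rw [Function.iterate_add_apply, Function.iterate_add_apply]
          exact mem_cell_itinerary.1 hzn j (by omega)
    _ ≤ partitionEntropy μ (itinerary T α n ∘ T^[m]) + partitionEntropy μ (itinerary T α m) :=
        partitionEntropy_prodMk_le_add hm hnm
    _ = partitionEntropy μ (itinerary T α m) + partitionEntropy μ (itinerary T α n) := by
        rw [partitionEntropy_comp (hT.iterate m) hn, add_comm]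

theorem tendsto_entropyRate (hT : MeasurePreserving T μ μ) (hα : Measurable α) :
    Tendsto (fun n : ℕ => partitionEntropy μ (itinerary T α n) / n) atTop
      (𝓝 (entropyRate T μ α)) := by
  have h := (subadditive_partitionEntropy_itinerary hT hα).tendsto_lim
    (bddBelow_partitionEntropy_itinerary_div T μ α)
  rwa [Subadditive.lim] at h

theorem mul_entropyRate_le (hT : MeasurePreserving T μ μ) (hα : Measurable α) (n : ℕ) :
    n * entropyRate T μ α ≤ partitionEntropy μ (itinerary T α n) := by
  rcases eq_or_ne n 0 with rfl | hn
  · simpa using partitionEntropy_nonneg (μ := μ) _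
  · have h := (subadditive_partitionEntropy_itinerary hT hα).lim_le_div
      (bddBelow_partitionEntropy_itinerary_div T μ α) hn
    rwa [Subadditive.lim, ← entropyRate, le_div_iff₀ (by positivity), mul_comm] at h

theorem entropyOfPartition_eq_entropyRate (hT : MeasurePreserving T μ μ) (hα : Measurable α) :
    entropyOfPartition T μ α = entropyRate T μ α :=
  ((continuous_coe_real_ereal.tendsto _).comp (tendsto_entropyRate hT hα)).limsup_eq

variable [Fintype κ] [MeasurableSpace κ] [MeasurableSingletonClass κ]

/-- Coding each letter of the `β`-itinerary by means of the `j` letters of the `α`-itinerary seen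
from its place. -/
theorem partitionEntropy_itinerary_le (hT : MeasurePreserving T μ μ) (hα : Measurable α)
    (hβ : Measurable β) {j : ℕ} {q : (Fin j → ι) → κ → ℝ} (hq : ∀ s b, 0 < q s b)
    (hq_sum : ∀ s, ∑ b, q s b ≤ 1) (n : ℕ) :
    partitionEntropy μ (itinerary T β n) ≤ partitionEntropy μ (itinerary T α (n + j)) +
      n * ∫ x, -Real.log (q (itinerary T α j x) (β x)) ∂μ := by
  have hβn := measurable_itinerary hT.measurable hβ n
  have hαj := measurable_itinerary hT.measurable hα j
  have hαnj := measurable_itinerary hT.measurable hα (n + j)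
  let Q (s : Fin (n + j) → ι) (b : Fin n → κ) : ℝ :=
    ∏ i : Fin n, q (fun l : Fin j => s ⟨l + i, by omega⟩) (b i)
  have hQ_sum (s) : ∑ b, Q s b ≤ 1 := by
    rw [← Fintype.piFinset_univ, Finset.sum_prod_piFinset]
    exact Finset.prod_le_one (fun i _ => Finset.sum_nonneg fun b _ => (hq _ _).le)
      fun i _ => hq_sum _
  have hQ_log (x) : -Real.log (Q (itinerary T α (n + j) x) (itinerary T β n x)) =
      birkhoffSum T (fun x => -Real.log (q (itinerary T α j x) (β x))) n x := by
    rw [Real.log_prod fun i _ => (hq _ _).ne', birkhoffSum, Finset.sum_neg_distrib,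
      ← Fin.sum_univ_eq_sum_range
        (fun i => Real.log (q (itinerary T α j (T^[i] x)) (β (T^[i] x))))]
    simp only [itinerary, Function.iterate_add_apply]
    rfl
  calc partitionEntropy μ (itinerary T β n)
      ≤ partitionEntropy μ fun x => (itinerary T β n x, itinerary T α (n + j) x) :=
        partitionEntropy_mono hβn (hβn.prodMk hαnj) fun _ _ hz => (Prod.mk.inj hz).1
    _ ≤ partitionEntropy μ (itinerary T α (n + j)) +
          ∫ x, -Real.log (Q (itinerary T α (n + j) x) (itinerary T β n x)) ∂μ :=
        partitionEntropy_prodMk_le hβn hαnj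
          (fun _ _ => Finset.prod_nonneg fun _ _ => (hq _ _).le) hQ_sum
          (.of_forall fun _ => Finset.prod_pos fun _ _ => hq _ _)
    _ = _ := by
        simp only [hQ_log]
        rw [integral_birkhoffSum hT]
        exact integrable_comp_of_finite (hαj.prodMk hβ) fun p => -Real.log (q p.1 p.2)

theorem entropyRate_le_add (hT : MeasurePreserving T μ μ) (hα : Measurable α)
    (hβ : Measurable β) {j : ℕ} {q : (Fin j → ι) → κ → ℝ} (hq : ∀ s b, 0 < q s b)
    (hq_sum : ∀ s, ∑ b, q s b ≤ 1) :
    entropyRate T μ β ≤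
      entropyRate T μ α + ∫ x, -Real.log (q (itinerary T α j x) (β x)) ∂μ := by
  set c := ∫ x, -Real.log (q (itinerary T α j x) (β x)) ∂μ
  have hlim := ((tendsto_entropyRate hT hα).add (tendsto_const_div_atTop_nhds_zero_nat
    (partitionEntropy μ (itinerary T α j)))).add_const c
  rw [add_zero] at hlim
  refine le_of_tendsto_of_tendsto (tendsto_entropyRate hT hβ) hlim ?_
  filter_upwards [eventually_gt_atTop 0] with n hn
  rw [← add_div, div_add' _ _ _ (by positivity)]
  gcongr
  have hcode := partitionEntropy_itinerary_le hT hα hβ hq hq_sum n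
  have hsub := subadditive_partitionEntropy_itinerary hT hα n j
  dsimp only at hsub
  linarith

theorem entropyRate_le_of_isGeneratingSequence (hT : MeasurePreserving T μ μ)
    (hα : IsGeneratingSequence (itinerary T α)) (hα' : Measurable α) (hβ : Measurable β) :
    entropyRate T μ β ≤ entropyRate T μ α := by
  refine le_of_forall_pos_le_add fun c hc => ?_
  have := (nonempty_of_isProbabilityMeasure μ).map β
  set L := |Real.log ((1 - Real.exp (-(c / 2))) / Fintype.card κ)|
  obtain ⟨j, g, hg⟩ := hα.exists_map_measureReal_ne_le μ hβ (ε := c / 2 / (L + 1)) (by positivity)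
  obtain ⟨q, hq, hq_sum, hq_int⟩ := exists_weights_integral_le (μ := μ)
    (hα.measurable j) hβ (half_pos hc) g
  have hgL : μ.real {x | β x ≠ g (itinerary T α j x)} * L ≤ c / 2 :=
    calc _ ≤ c / 2 / (L + 1) * (L + 1) := by gcongr; linarith
      _ = c / 2 := div_mul_cancel₀ _ (by positivity)
  have := entropyRate_le_add hT hα' hβ hq hq_sum
  linarith

/-- The Kolmogorov–Sinai theorem. -/
theorem entropy_eq_entropyRate {k : ℕ} {α : Ω → Fin k} (hT : MeasurePreserving T μ μ)
    (hα : IsGeneratingSequence (itinerary T α)) (hα' : Measurable α) :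
    entropy T μ = entropyRate T μ α := by
  refine le_antisymm (iSup_le fun m => iSup_le fun β => iSup_le fun hβ => ?_) ?_
  · rw [entropyOfPartition_eq_entropyRate hT hβ]
    exact EReal.coe_le_coe (entropyRate_le_of_isGeneratingSequence hT hα hα' hβ)
  · rw [← entropyOfPartition_eq_entropyRate hT hα']
    exact le_iSup_of_le k (le_iSup_of_le α (le_iSup_of_le hα' le_rfl))

end EntropyRate

section Cylinders

variable {k : ℕ} (X : Subshift (Fin k) ℕ)

/-- The letter `x₁` of a point. -/
def firstLetter (x : X.carrier) : Fin k := x.1 0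

/-- The word `x₁ … xₙ` of a point, read off its orbit under the shift. -/
abbrev word (n : ℕ) : X.carrier → Fin n → Fin k := itinerary (sigma X) (firstLetter X) n

variable {X}

theorem sigma_iterate_apply (n : ℕ) (x : X.carrier) (i : ℕ) :
    ((sigma X)^[n] x).1 i = x.1 (n + i) := by
  induction n generalizing x with
  | zero => rw [Nat.zero_add]; rfl
  | succ n ih =>
    rw [Function.iterate_succ_apply, ih, Nat.succ_add]
    exact congrArg x.1 (Nat.add_comm 1 (n + i))

theorem word_apply (n : ℕ) (x : X.carrier) (i : Fin n) : word X n x i = x.1 i :=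
  sigma_iterate_apply i x 0

theorem cyl_eq_cell (n : ℕ) (x : X.carrier) : cyl X n x = cell (word X n) x := by
  ext z
  simp only [mem_cell_itinerary, firstLetter, sigma_iterate_apply, Nat.add_zero]
  rfl

theorem cyl_zero (x : X.carrier) : cyl X 0 x = univ :=
  eq_univ_of_forall fun _ _ hi => absurd hi (Nat.not_lt_zero _)

theorem cyl_anti (x : X.carrier) : Antitone fun n => cyl X n x :=
  fun _ _ hmn _ hz i hi => hz i (hi.trans_le hmn)

theorem cyl_eq_of_mem {n : ℕ} {x z : X.carrier} (hz : z ∈ cyl X n x) : cyl X n z = cyl X n x := by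
  rw [cyl_eq_cell] at hz ⊢
  rw [cyl_eq_cell, cell, mem_singleton_iff.1 hz, cell]

theorem cyl_add_subset {n m : ℕ} {x y z : X.carrier} (hx : z ∈ cyl X n x) {j : ℕ} (hj : n ≤ j)
    (hy : (sigma X)^[j] z ∈ cyl X m y) :
    cyl X (j + m) z ⊆ cyl X n x ∩ (sigma X)^[j] ⁻¹' cyl X m y := by
  refine fun t ht => ⟨fun i hi => (ht i (by omega)).trans (hx i hi), fun i hi => ?_⟩
  rw [← hy i hi, sigma_iterate_apply, sigma_iterate_apply]
  exact ht _ (by omega)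

theorem measurable_firstLetter : Measurable (firstLetter X) :=
  (measurable_pi_apply 0).comp measurable_subtype_coe

theorem measurable_sigma : Measurable (sigma X) :=
  Measurable.subtype_mk (f := fun x : X.carrier => SymbolicDynamics.FullShift.shift 1 x.1)
    (measurable_pi_lambda _ fun i => (measurable_pi_apply (1 + i)).comp measurable_subtype_coe)

theorem measurable_word (n : ℕ) : Measurable (word X n) :=
  measurable_itinerary measurable_sigma measurable_firstLetter n

theorem isGeneratingSequence_word (X : Subshift (Fin k) ℕ) : IsGeneratingSequence (word X) where
  measurable := measurable_word
  cell_anti := cell_itinerary_anti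
  generateFrom_eq := by
    refine le_antisymm ?_ (MeasurableSpace.generateFrom_le ?_)
    · rw [Subtype.instMeasurableSpace, MeasurableSpace.pi, MeasurableSpace.comap_iSup]
      refine iSup_le fun i => ?_
      rw [MeasurableSpace.comap_comp]
      rintro _ ⟨A, -, rfl⟩
      refine MeasurableSpace.measurableSet_generateFrom
        ⟨i + 1, {w | w (Fin.last i) ∈ A}, ext fun x => ?_⟩
      rw [mem_preimage, mem_ofPred_eq, word_apply]
      rfl
    · rintro _ ⟨n, S, rfl⟩
      exact measurable_word n S.toFinite.measurableSet

theorem entropy_sigma_eq_entropyRate {μ : Measure X.carrier} (hμ : μ ∈ invMeasures X) :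
    entropy (sigma X) μ = entropyRate (sigma X) μ (firstLetter X) :=
  have := hμ.1
  entropy_eq_entropyRate hμ.2 (isGeneratingSequence_word X) measurable_firstLetter

theorem ofFn_word_mem_language (n : ℕ) (x : X.carrier) :
    List.ofFn (word X n x) ∈ language X :=
  ⟨x.1, x.2, 0, fun j hj => by simp only [List.getElem_ofFn, word_apply, Nat.zero_add]⟩

theorem WeakSpecification.exists_mem_cyl (hX : WeakSpecification X) :
    ∃ p : ℕ, ∀ n m (x y : X.carrier), ∃ l ≤ p, ∃ z : X.carrier,
      z ∈ cyl X n x ∧ (sigma X)^[n + l] z ∈ cyl X m y := by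
  obtain ⟨p, hp⟩ := hX
  refine ⟨p, fun n m x y => ?_⟩
  obtain ⟨w, -, hw, z, hz, i, h⟩ :=
    hp _ (ofFn_word_mem_language n x) _ (ofFn_word_mem_language m y)
  lift z to X.carrier using hz
  simp only [List.length_append, List.length_ofFn] at h
  refine ⟨w.length, hw, (sigma X)^[i] z, fun j hj => ?_, fun j hj => ?_⟩
  · rw [sigma_iterate_apply, ← h j (by omega), List.getElem_append_left (by simp; omega),
      List.getElem_append_left (by simpa using hj), List.getElem_ofFn, word_apply]
  · rw [sigma_iterate_apply, sigma_iterate_apply, ← h (n + w.length + j) (by omega),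
      List.getElem_append_right (by simp)]
    simp only [List.length_append, List.length_ofFn, Nat.add_sub_cancel_left, List.getElem_ofFn,
      word_apply]

end Cylinders

section LogGibbs

variable {k : ℕ} {X : Subshift (Fin k) ℕ} {φ : ℕ → X.carrier → ℝ} {μ ν : Measure X.carrier}
  {P P' : ℝ} {D D' : ℕ → ℝ}

theorem crossEntropy_word (μ ν : Measure X.carrier) (n : ℕ) :
    crossEntropy μ ν (word X n) = -∫ x, Real.log (ν.real (cyl X n x)) ∂μ := by
  simp only [crossEntropy, cyl_eq_cell, integral_neg]

theorem integrable_log_measureReal_cyl (ν : Measure X.carrier) [IsFiniteMeasure μ] (n : ℕ) :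
    Integrable (fun x => Real.log (ν.real (cyl X n x))) μ := by
  simp only [cyl_eq_cell]
  exact integrable_comp_of_finite (measurable_word n) fun s =>
    Real.log (ν.real (word X n ⁻¹' {s}))

/-- The Gibbs bounds `e^{-D n} ≤ ν[x₁ … xₙ] / e^{-nP + φ n x} ≤ e^{D n}` in logarithmic form, which
treats the sequences `log f n` and the Birkhoff sums of a function alike. Positivity of the measures
of cylinders has to be required since `Real.log 0 = 0`. -/
structure LogGibbsBounds (X : Subshift (Fin k) ℕ) (φ : ℕ → X.carrier → ℝ)
    (ν : Measure X.carrier) (P : ℝ) (D : ℕ → ℝ) : Prop where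
  measureReal_cyl_pos : ∀ n x, 0 < ν.real (cyl X n x)
  abs_log_sub_le : ∀ n ≥ 1, ∀ x, |Real.log (ν.real (cyl X n x)) + n * P - φ n x| ≤ D n

theorem GibbsBounds.logGibbsBounds {f : ℕ → X.carrier → ℝ} {C : ℕ → ℝ} [IsProbabilityMeasure ν]
    (h : GibbsBounds X f ν P C) (hf : ∀ n ≥ 1, ∀ x, 0 < f n x) (hC : ∀ n ≥ 1, 0 < C n) :
    LogGibbsBounds X (fun n x => Real.log (f n x)) ν P fun n => Real.log (C n) := by
  have hpos (n : ℕ) (x : X.carrier) : 0 < ν.real (cyl X n x) := by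
    rcases Nat.eq_zero_or_pos n with rfl | hn
    · rw [cyl_zero, probReal_univ]
      exact one_pos
    · exact (div_pos_iff_of_pos_right (mul_pos (Real.exp_pos _) (hf n hn x))).1
        ((one_div_pos.2 (hC n hn)).trans_le (h n hn x).1)
  refine ⟨hpos, fun n hn x => ?_⟩
  have hfx := hf n hn x
  have hCn := hC n hn
  have hνx := hpos n x
  have hlog : Real.log (ν.real (cyl X n x) / (Real.exp (-(n * P)) * f n x)) =
      Real.log (ν.real (cyl X n x)) + n * P - Real.log (f n x) := by
    rw [Real.log_div hνx.ne' (by positivity), Real.log_mul (Real.exp_ne_zero _) hfx.ne',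
      Real.log_exp]
    ring
  rw [← hlog, abs_le, ← Real.log_inv, inv_eq_one_div]
  exact ⟨Real.log_le_log (by positivity) (h n hn x).1,
    Real.log_le_log (by positivity) (h n hn x).2⟩

theorem LogGibbsBounds.gibbsBounds_expBirkhoff {g : X.carrier → ℝ}
    (h : LogGibbsBounds X (birkhoffSum (sigma X) g) ν P D) :
    GibbsBounds X (expBirkhoff X g) ν P fun n => Real.exp (D n) := by
  intro n hn x
  have hexp : ν.real (cyl X n x) / (Real.exp (-(n * P)) * expBirkhoff X g n x) =
      Real.exp (Real.log (ν.real (cyl X n x)) + n * P - birkhoffSum (sigma X) g n x) := by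
    rw [Real.exp_sub, Real.exp_add (Real.log _), Real.exp_log (h.measureReal_cyl_pos n x),
      Real.exp_neg, expBirkhoff]
    field_simp
  rw [hexp, one_div, ← Real.exp_neg, Real.exp_le_exp, Real.exp_le_exp]
  exact abs_le.1 (h.abs_log_sub_le n hn x)

namespace LogGibbsBounds

theorem integrable (h : LogGibbsBounds X φ ν P D) [IsFiniteMeasure μ] {n : ℕ} (hn : 1 ≤ n)
    (hφ : AEStronglyMeasurable (φ n) μ) : Integrable (φ n) μ := by
  have hν : Integrable (fun x => Real.log (ν.real (cyl X n x)) + n * P) μ :=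
    (integrable_log_measureReal_cyl ν n).add (integrable_const _)
  have hdiff : Integrable (fun x => Real.log (ν.real (cyl X n x)) + n * P - φ n x) μ :=
    Integrable.of_bound (hν.1.sub hφ) (D n) (Eventually.of_forall (h.abs_log_sub_le n hn))
  exact (hν.sub hdiff).congr (Eventually.of_forall fun x => sub_sub_cancel _ _)

variable [IsProbabilityMeasure μ]

theorem abs_crossEntropy_add_integral_sub_le (h : LogGibbsBounds X φ ν P D) {n : ℕ} (hn : 1 ≤ n)
    (hφ : Integrable (φ n) μ) :
    |crossEntropy μ ν (word X n) + ∫ x, φ n x ∂μ - n * P| ≤ D n := by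
  have hν : Integrable (fun x => Real.log (ν.real (cyl X n x))) μ :=
    integrable_log_measureReal_cyl ν n
  have hνP : Integrable (fun x => Real.log (ν.real (cyl X n x)) + n * P) μ :=
    hν.add (integrable_const _)
  have hint : ∫ x, (Real.log (ν.real (cyl X n x)) + n * P - φ n x) ∂μ =
      -(crossEntropy μ ν (word X n) + ∫ x, φ n x ∂μ - n * P) := by
    rw [integral_sub hνP hφ, integral_add hν (integrable_const _), integral_const, probReal_univ,
      one_smul, crossEntropy_word]
    ring
  rw [← abs_neg, ← hint]
  exact (abs_integral_le_integral_abs).trans <|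
    (integral_mono (hνP.sub hφ).abs (integrable_const (D n)) (h.abs_log_sub_le n hn)).trans_eq <| by
      rw [integral_const, probReal_univ, one_smul]

theorem tendsto_crossEntropy_add_integral_div (h : LogGibbsBounds X φ ν P D)
    (hD : Tendsto (fun n : ℕ => D n / n) atTop (𝓝 0)) (hφ : ∀ n ≥ 1, Integrable (φ n) μ) :
    Tendsto (fun n : ℕ => (crossEntropy μ ν (word X n) + ∫ x, φ n x ∂μ) / n) atTop (𝓝 P) := by
  refine tendsto_sub_nhds_zero_iff.1 (squeeze_zero_norm' ?_ hD)
  filter_upwards [eventually_ge_atTop 1] with n hn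
  have hn' : (0 : ℝ) < n := Nat.cast_pos.2 hn
  rw [Real.norm_eq_abs, div_sub' hn'.ne', abs_div, abs_of_pos hn']
  gcongr
  exact h.abs_crossEntropy_add_integral_sub_le hn (hφ n hn)

theorem measure_cyl_le [IsFiniteMeasure ν] (hμ : LogGibbsBounds X φ μ P' D')
    (hν : LogGibbsBounds X φ ν P D) {n : ℕ} (hn : 1 ≤ n) (x : X.carrier) :
    μ (cyl X n x) ≤
      (ENNReal.ofReal (Real.exp (n * (P - P') + (D n + D' n))) • ν) (cyl X n x) := by
  rw [Measure.smul_apply, smul_eq_mul, ← ofReal_measureReal (μ := μ), ← ofReal_measureReal (μ := ν),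
    ← ENNReal.ofReal_mul (Real.exp_nonneg _), ← Real.exp_log (hμ.measureReal_cyl_pos n x),
    ← Real.exp_log (hν.measureReal_cyl_pos n x), ← Real.exp_add]
  refine ENNReal.ofReal_le_ofReal (Real.exp_le_exp.2 ?_)
  linarith [abs_le.1 (hμ.abs_log_sub_le n hn x), abs_le.1 (hν.abs_log_sub_le n hn x)]

theorem pressure_le [IsProbabilityMeasure ν] (hμ : LogGibbsBounds X φ μ P' D')
    (hν : LogGibbsBounds X φ ν P D) (hD : Tendsto (fun n : ℕ => D n / n) atTop (𝓝 0))
    (hD' : Tendsto (fun n : ℕ => D' n / n) atTop (𝓝 0)) : P' ≤ P := by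
  have hlim : Tendsto (fun n : ℕ => P - P' + (D n / n + D' n / n)) atTop (𝓝 (P - P')) := by
    simpa using (hD.add hD').const_add (P - P')
  refine sub_nonneg.1 (ge_of_tendsto hlim ?_)
  filter_upwards [eventually_ge_atTop 1] with n hn
  have hle := measure_preimage_le_of_cell_le (measurable_word n)
    (fun x => by simpa only [← cyl_eq_cell] using hμ.measure_cyl_le hν hn x) univ
  rw [preimage_univ, Measure.smul_apply, measure_univ, measure_univ, smul_eq_mul, mul_one,
    ENNReal.one_le_ofReal, Real.one_le_exp_iff] at hle
  have hn' : (0 : ℝ) < n := Nat.cast_pos.2 hn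
  calc 0 ≤ (n * (P - P') + (D n + D' n)) / n := div_nonneg hle hn'.le
    _ = P - P' + (D n / n + D' n / n) := by field_simp

theorem absolutelyContinuous [IsProbabilityMeasure ν] {D D' : ℝ}
    (hμ : LogGibbsBounds X φ μ P' fun _ => D') (hν : LogGibbsBounds X φ ν P fun _ => D) :
    μ ≪ ν := by
  have hlim (c : ℝ) := tendsto_const_div_atTop_nhds_zero_nat c
  obtain rfl : P = P' :=
    le_antisymm (hν.pressure_le hμ (hlim _) (hlim _)) (hμ.pressure_le hν (hlim _) (hlim _))
  have hfin : IsFiniteMeasure (ENNReal.ofReal (Real.exp (D + D')) • ν) :=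
    ν.smul_finite ENNReal.ofReal_ne_top
  refine Measure.absolutelyContinuous_of_le_smul (c := ENNReal.ofReal (Real.exp (D + D'))) <|
    (isGeneratingSequence_word X).measure_le_of_cell_le ?_
  filter_upwards [eventually_ge_atTop 1] with n hn x
  simpa only [← cyl_eq_cell, sub_self, mul_zero, zero_add] using hμ.measure_cyl_le hν hn x

end LogGibbsBounds

end LogGibbs

section EquilibriumStates

variable {k : ℕ} {X : Subshift (Fin k) ℕ} {μ ν : Measure X.carrier} {P : ℝ} {D : ℕ → ℝ}
  {g : X.carrier → ℝ}

namespace LogGibbsBounds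

theorem tendsto_crossEntropy_div (h : LogGibbsBounds X (birkhoffSum (sigma X) g) ν P D)
    (hD : Tendsto (fun n : ℕ => D n / n) atTop (𝓝 0)) (hμ : μ ∈ invMeasures X)
    (hg : Integrable g μ) :
    Tendsto (fun n : ℕ => crossEntropy μ ν (word X n) / n) atTop (𝓝 (P - ∫ x, g x ∂μ)) := by
  have := hμ.1
  have hlim := (h.tendsto_crossEntropy_add_integral_div hD fun n _ =>
    integrable_birkhoffSum hμ.2 hg n).sub_const
    (∫ x, g x ∂μ)
  refine hlim.congr' ?_
  filter_upwards [eventually_ne_atTop 0] with n hn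
  rw [integral_birkhoffSum hμ.2 hg]
  field_simp
  ring

theorem entropy_add_integral_le (h : LogGibbsBounds X (birkhoffSum (sigma X) g) ν P D)
    (hD : Tendsto (fun n : ℕ => D n / n) atTop (𝓝 0)) [IsProbabilityMeasure ν]
    (hμ : μ ∈ invMeasures X) (hg : Integrable g μ) :
    entropy (sigma X) μ + ((∫ x, g x ∂μ : ℝ) : EReal) ≤ P := by
  have := hμ.1
  have hrate : entropyRate (sigma X) μ (firstLetter X) ≤ P - ∫ x, g x ∂μ := by
    refine ge_of_tendsto (h.tendsto_crossEntropy_div hD hμ hg) ?_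
    filter_upwards [eventually_gt_atTop 0] with n hn
    rw [le_div_iff₀' (Nat.cast_pos.2 hn)]
    exact (mul_entropyRate_le hμ.2 measurable_firstLetter n).trans <|
      partitionEntropy_le_crossEntropy (measurable_word n) <| Eventually.of_forall fun x => by
        simpa only [← cyl_eq_cell] using h.measureReal_cyl_pos n x
  rw [entropy_sigma_eq_entropyRate hμ, ← EReal.coe_add, EReal.coe_le_coe_iff]
  linarith

theorem entropy_add_integral_self (h : LogGibbsBounds X (birkhoffSum (sigma X) g) ν P D)
    (hD : Tendsto (fun n : ℕ => D n / n) atTop (𝓝 0)) (hν : ν ∈ invMeasures X)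
    (hg : Integrable g ν) : entropy (sigma X) ν + ((∫ x, g x ∂ν : ℝ) : EReal) = P := by
  have := hν.1
  have hlim := h.tendsto_crossEntropy_div hD hν hg
  simp only [crossEntropy_self (measurable_word _)] at hlim
  rw [entropy_sigma_eq_entropyRate hν,
    tendsto_nhds_unique (tendsto_entropyRate hν.2 measurable_firstLetter) hlim,
    ← EReal.coe_add, sub_add_cancel]

theorem iSup_entropy_add_integral (h : LogGibbsBounds X (birkhoffSum (sigma X) g) ν P D)
    (hD : Tendsto (fun n : ℕ => D n / n) atTop (𝓝 0)) (hν : ν ∈ invMeasures X)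
    (hg : ∀ m ∈ invMeasures X, Integrable g m) :
    ⨆ m ∈ invMeasures X, entropy (sigma X) m + ((∫ x, g x ∂m : ℝ) : EReal) = P := by
  have := hν.1
  refine le_antisymm (iSup₂_le fun m hm => h.entropy_add_integral_le hD hm (hg m hm)) ?_
  rw [← h.entropy_add_integral_self hD hν (hg ν hν)]
  exact le_iSup₂ (f := fun m (_ : m ∈ invMeasures X) =>
    entropy (sigma X) m + ((∫ x, g x ∂m : ℝ) : EReal)) ν hν

theorem isEquilibriumFun (h : LogGibbsBounds X (birkhoffSum (sigma X) g) ν P D)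
    (hD : Tendsto (fun n : ℕ => D n / n) atTop (𝓝 0)) (hν : ν ∈ invMeasures X)
    (hg : ∀ m ∈ invMeasures X, Integrable g m) : IsEquilibriumFun X g ν :=
  ⟨hν, (h.entropy_add_integral_self hD hν (hg ν hν)).trans
    (h.iSup_entropy_add_integral hD hν hg).symm⟩

theorem absolutelyContinuous_of_isEquilibriumFun {D : ℝ}
    (h : LogGibbsBounds X (birkhoffSum (sigma X) g) ν P fun _ => D) (hν : ν ∈ invMeasures X)
    (hg : ∀ m ∈ invMeasures X, Integrable g m) (hμ : IsEquilibriumFun X g μ) : μ ≪ ν := by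
  obtain ⟨hμ, heq⟩ := hμ
  have := hμ.1
  have := hν.1
  have hrate : entropyRate (sigma X) μ (firstLetter X) + ∫ x, g x ∂μ = P := by
    rw [h.iSup_entropy_add_integral (tendsto_const_div_atTop_nhds_zero_nat D) hν hg,
      entropy_sigma_eq_entropyRate hμ, ← EReal.coe_add] at heq
    exact EReal.coe_injective heq
  refine (isGeneratingSequence_word X).absolutelyContinuous_of_crossEntropy_sub_le (K := D)
    (fun n => Eventually.of_forall fun x => by
      simpa only [← cyl_eq_cell] using h.measureReal_cyl_pos n x) ?_
  filter_upwards [eventually_ge_atTop 1] with n hn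
  have hcross := (abs_le.1 (h.abs_crossEntropy_add_integral_sub_le hn
    (integrable_birkhoffSum hμ.2 (hg μ hμ) n))).2
  rw [integral_birkhoffSum hμ.2 (hg μ hμ)] at hcross
  calc crossEntropy μ ν (word X n) - partitionEntropy μ (word X n)
      ≤ crossEntropy μ ν (word X n) - n * entropyRate (sigma X) μ (firstLetter X) := by
        gcongr
        exact mul_entropyRate_le hμ.2 measurable_firstLetter n
    _ = crossEntropy μ ν (word X n) + n * ∫ x, g x ∂μ - n * P := by
        rw [← hrate]
        ring
    _ ≤ D := hcross

theorem integralLimits {f : ℕ → X.carrier → ℝ} {D' : ℕ → ℝ}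
    (h : LogGibbsBounds X (birkhoffSum (sigma X) g) ν P D)
    (hD : Tendsto (fun n : ℕ => D n / n) atTop (𝓝 0))
    (hg : ∀ m ∈ invMeasures X, Integrable g m)
    (hf : LogGibbsBounds X (fun n x => Real.log (f n x)) ν P D')
    (hD' : Tendsto (fun n : ℕ => D' n / n) atTop (𝓝 0)) (hfm : ∀ n ≥ 1, Measurable (f n)) :
    IntegralLimits X f ν P g := by
  intro μ hμ
  have := hμ.1
  have hcross := h.tendsto_crossEntropy_div hD hμ (hg μ hμ)
  constructor
  · have hsum := hf.tendsto_crossEntropy_add_integral_div hD' fun n hn =>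
      hf.integrable hn (hfm n hn).log.aestronglyMeasurable (μ := μ)
    refine (sub_sub_cancel P (∫ x, g x ∂μ) ▸ hsum.sub hcross).congr fun n => ?_
    ring
  · refine (sub_sub_cancel P (∫ x, g x ∂μ) ▸ hcross.const_sub P).congr' ?_
    filter_upwards [eventually_ne_atTop 0] with n hn
    simp only [Real.log_mul (h.measureReal_cyl_pos n _).ne' (Real.exp_ne_zero _), Real.log_exp]
    rw [integral_add (integrable_log_measureReal_cyl ν n) (integrable_const _), integral_const,
      probReal_univ, one_smul, crossEntropy_word]
    field_simp
    ring

end LogGibbsBounds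

theorem IntegralLimits.isEquilibriumSeq_iff {f : ℕ → X.carrier → ℝ}
    (hlim : IntegralLimits X f ν P g) : IsEquilibriumSeq X f μ ↔ IsEquilibriumFun X g μ := by
  constructor
  · rintro ⟨hμ, L, hL, hsup⟩
    have hLg (m : Measure X.carrier) (hm : m ∈ invMeasures X) : L m = ∫ x, g x ∂m :=
      tendsto_nhds_unique (hL m hm) (hlim m hm).1
    refine ⟨hμ, ?_⟩
    rw [← hLg μ hμ, hsup]
    exact iSup_congr fun m => iSup_congr fun hm => by rw [hLg m hm]
  · rintro ⟨hμ, hsup⟩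
    exact ⟨hμ, fun m => ∫ x, g x ∂m, fun m hm => (hlim m hm).1, hsup⟩

theorem LogGibbsBounds.eq_of_isEquilibriumFun {D : ℝ}
    (h : LogGibbsBounds X (birkhoffSum (sigma X) g) ν P fun _ => D) (hν : ν ∈ invMeasures X)
    (herg : Ergodic (sigma X) ν) (hg : ∀ m ∈ invMeasures X, Integrable g m)
    (hμ : IsEquilibriumFun X g μ) : μ = ν :=
  have := hν.1
  have := hμ.1.1
  herg.eq_of_absolutelyContinuous hμ.1.2 (h.absolutelyContinuous_of_isEquilibriumFun hν hg hμ)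

theorem LogGibbsBounds.eq_of_isGibbs {D : ℝ}
    (h : LogGibbsBounds X (birkhoffSum (sigma X) g) ν P fun _ => D) (hν : ν ∈ invMeasures X)
    (herg : Ergodic (sigma X) ν) (hμ : IsGibbs X (expBirkhoff X g) μ) : μ = ν := by
  obtain ⟨hμ, P', C, hC, hbounds⟩ := hμ
  have := hν.1
  have := hμ.1
  have hlog := hbounds.logGibbsBounds (fun _ _ _ => Real.exp_pos _) fun _ _ => hC
  simp only [expBirkhoff, Real.log_exp] at hlog
  exact herg.eq_of_absolutelyContinuous hμ.2 (hlog.absolutelyContinuous h)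

end EquilibriumStates

section QuasiBernoulli

variable {k : ℕ} {X : Subshift (Fin k) ℕ} {ν : Measure X.carrier} {C : ℕ → ℝ} {P : ℝ}
  {r : X.carrier → ℝ}

/-- `ν` is quasi-Bernoulli with error `C`: up to a factor `e^{± C n}`, the `ν`-measure of the
cylinder of a concatenation `uv` with `u` of length `n` is the product of the measures of the
cylinders of `u` and `v`. The words `u` and `v` may be empty. -/
structure IsQuasiBernoulli (X : Subshift (Fin k) ℕ) (ν : Measure X.carrier) (C : ℕ → ℝ) :
    Prop where
  measureReal_cyl_pos : ∀ n x, 0 < ν.real (cyl X n x)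
  abs_log_sub_le : ∀ n m x,
    |Real.log (ν.real (cyl X (n + m) x)) - Real.log (ν.real (cyl X n x)) -
      Real.log (ν.real (cyl X m ((sigma X)^[n] x)))| ≤ C n

theorem AdditiveBounds.abs_log_sub_le {f : ℕ → X.carrier → ℝ} (h : AdditiveBounds X f C)
    (hf : ∀ n ≥ 1, ∀ x, 0 < f n x) {n m : ℕ} (hn : 1 ≤ n) (hm : 1 ≤ m) (x : X.carrier) :
    |Real.log (f (n + m) x) - Real.log (f n x) - Real.log (f m ((sigma X)^[n] x))| ≤ C n := by
  have hfn := hf n hn x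
  have hfm := hf m hm ((sigma X)^[n] x)
  have hle := Real.log_le_log (hf (n + m) (hn.trans (n.le_add_right m)) x) (h n hn m hm x).1
  have hge := Real.log_le_log (by positivity) (h n hn m hm x).2
  rw [Real.log_mul (by positivity) hfm.ne', Real.log_mul (by positivity) hfn.ne', Real.log_exp]
    at hle hge
  exact abs_le.2 ⟨by linarith, by linarith⟩

theorem LogGibbsBounds.isQuasiBernoulli [IsProbabilityMeasure ν] {φ : ℕ → X.carrier → ℝ} {D : ℝ}
    (h : LogGibbsBounds X φ ν P fun _ => D)
    (hφ : ∀ n ≥ 1, ∀ m ≥ 1, ∀ x, |φ (n + m) x - φ n x - φ m ((sigma X)^[n] x)| ≤ C n) :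
    IsQuasiBernoulli X ν fun n => |C n| + 3 * |D| := by
  refine ⟨h.measureReal_cyl_pos, fun n m x => ?_⟩
  rcases Nat.eq_zero_or_pos n with rfl | hn
  · simp only [Nat.zero_add, Function.iterate_zero_apply, cyl_zero, probReal_univ, Real.log_one,
      sub_zero, sub_self, abs_zero]
    positivity
  rcases Nat.eq_zero_or_pos m with rfl | hm
  · simp only [Nat.add_zero, cyl_zero, probReal_univ, Real.log_one, sub_self, abs_zero]
    positivity
  have hnm := abs_le.1 (h.abs_log_sub_le (n + m) (Nat.le_add_right_of_le hn) x)
  have hn' := abs_le.1 (h.abs_log_sub_le n hn x)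
  have hm' := abs_le.1 (h.abs_log_sub_le m hm ((sigma X)^[n] x))
  have hadd := abs_le.1 (hφ n hn m hm x)
  push_cast at hnm
  have hC := le_abs_self (C n)
  have hD := le_abs_self D
  exact abs_le.2 ⟨by linarith, by linarith⟩

theorem exists_abs_log_measureReal_cyl_le (ν : Measure X.carrier) (n : ℕ) :
    ∃ E, ∀ x, |Real.log (ν.real (cyl X n x))| ≤ E := by
  obtain ⟨E, hE⟩ := Finite.exists_le fun s => |Real.log (ν.real (word X n ⁻¹' {s}))|
  exact ⟨E, fun x => by simpa only [cyl_eq_cell, cell] using hE (word X n x)⟩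

theorem exists_tendsto_of_liminf_eq_limsup {u : ℕ → ℝ} {K : ℝ} (hu : ∀ n, |u n| ≤ K)
    (h : liminf (fun n => (u n : EReal)) atTop = limsup (fun n => (u n : EReal)) atTop) :
    ∃ l, Tendsto u atTop (𝓝 l) := by
  have hlim := tendsto_of_liminf_eq_limsup h rfl
  have hmem : limsup (fun n => (u n : EReal)) atTop ∈ Icc ((-K : ℝ) : EReal) (K : EReal) :=
    isClosed_Icc.mem_of_tendsto hlim <| Eventually.of_forall fun n =>
      ⟨EReal.coe_le_coe_iff.2 (abs_le.1 (hu n)).1, EReal.coe_le_coe_iff.2 (abs_le.1 (hu n)).2⟩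
  lift limsup (fun n => (u n : EReal)) atTop to ℝ using
    ⟨(hmem.2.trans_lt (EReal.coe_lt_top K)).ne, ((EReal.bot_lt_coe (-K)).trans_le hmem.1).ne'⟩
    with l
  exact ⟨l, EReal.tendsto_coe.1 hlim⟩

theorem measurable_logRatio (ν : Measure X.carrier) (n : ℕ) : Measurable (logRatio X ν n) := by
  have hcyl (n : ℕ) : Measurable fun x => ν.real (cyl X n x) := by
    simp only [cyl_eq_cell]
    exact (measurable_of_finite fun s => ν.real (word X n ⁻¹' {s})).comp (measurable_word n)
  exact ((hcyl (n + 1)).div ((hcyl n).comp measurable_sigma)).log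

theorem IsLimitPotential.measurable (hr : IsLimitPotential X ν P r) : Measurable r :=
  measurable_of_tendsto_metrizable (fun n => (measurable_logRatio ν n).add_const P)
    (tendsto_pi_nhds.2 hr)

namespace IsQuasiBernoulli

theorem logRatio_eq_sub (h : IsQuasiBernoulli X ν C) (n : ℕ) (x : X.carrier) :
    logRatio X ν n x =
      Real.log (ν.real (cyl X (n + 1) x)) - Real.log (ν.real (cyl X n (sigma X x))) :=
  Real.log_div (h.measureReal_cyl_pos _ _).ne' (h.measureReal_cyl_pos _ _).ne'

theorem exists_abs_logRatio_le (h : IsQuasiBernoulli X ν C) :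
    ∃ K, ∀ n x, |logRatio X ν n x| ≤ K := by
  obtain ⟨E, hE⟩ := exists_abs_log_measureReal_cyl_le ν 1
  refine ⟨C 1 + E, fun n x => ?_⟩
  have hsplit := abs_le.1 (h.abs_log_sub_le 1 n x)
  have hletter := abs_le.1 (hE x)
  rw [Function.iterate_one, Nat.add_comm 1 n] at hsplit
  rw [h.logRatio_eq_sub]
  exact abs_le.2 ⟨by linarith, by linarith⟩

theorem exists_isLimitPotential (h : IsQuasiBernoulli X ν C)
    (hr : ∀ x, rLower X ν P x = rUpper X ν P x) : ∃ r, IsLimitPotential X ν P r := by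
  obtain ⟨K, hK⟩ := h.exists_abs_logRatio_le
  have hlim (x : X.carrier) : ∃ l, Tendsto (fun n => logRatio X ν n x) atTop (𝓝 l) :=
    exists_tendsto_of_liminf_eq_limsup (fun n => hK n x) <| by
      simpa only [rLower, rUpper, EReal.add_sub_cancel_right] using
        congrArg (· - (P : EReal)) (hr x)
  choose l hl using hlim
  exact ⟨fun x => l x + P, fun x => (hl x).add_const P⟩

theorem exists_abs_le (h : IsQuasiBernoulli X ν C) (hr : IsLimitPotential X ν P r) :
    ∃ K, ∀ x, |r x| ≤ K := by
  obtain ⟨K, hK⟩ := h.exists_abs_logRatio_le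
  refine ⟨K + |P|, fun x => le_of_tendsto' (hr x).abs fun n => ?_⟩
  exact (abs_add_le _ _).trans (add_le_add_left (hK n x) _)

theorem tendsto_birkhoffSum (h : IsQuasiBernoulli X ν C) (hr : IsLimitPotential X ν P r) (n : ℕ)
    (x : X.carrier) :
    Tendsto (fun m => Real.log (ν.real (cyl X (n + m) x)) -
      Real.log (ν.real (cyl X m ((sigma X)^[n] x))) + n * P) atTop
      (𝓝 (birkhoffSum (sigma X) r n x)) := by
  induction n with
  | zero => simp
  | succ n ih =>
    rw [birkhoffSum_succ]
    refine (((tendsto_add_atTop_iff_nat 1).2 ih).add (hr ((sigma X)^[n] x))).congr fun m => ?_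
    rw [h.logRatio_eq_sub, ← Function.iterate_succ_apply' (sigma X), Nat.add_right_comm n 1 m,
      ← Nat.add_assoc n m 1]
    push_cast
    ring

theorem logGibbsBounds (h : IsQuasiBernoulli X ν C) (hr : IsLimitPotential X ν P r) :
    LogGibbsBounds X (birkhoffSum (sigma X) r) ν P C where
  measureReal_cyl_pos := h.measureReal_cyl_pos
  abs_log_sub_le n _ x := by
    refine le_of_tendsto' ((h.tendsto_birkhoffSum hr n x).const_sub _).abs fun m => ?_
    rw [abs_sub_comm]
    refine (congrArg abs ?_).trans_le (h.abs_log_sub_le n m x)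
    ring

theorem mul_measureReal_cyl_le {C : ℝ} (h : IsQuasiBernoulli X ν fun _ => C) {n l m : ℕ} {E : ℝ}
    {x y z : X.carrier} (hx : z ∈ cyl X n x) (hy : (sigma X)^[n + l] z ∈ cyl X m y)
    (hE : -E ≤ Real.log (ν.real (cyl X l ((sigma X)^[n] z)))) :
    Real.exp (-E - 2 * C) * ν.real (cyl X n x) * ν.real (cyl X m y) ≤
      ν.real (cyl X (n + l + m) z) := by
  have houter := abs_le.1 (h.abs_log_sub_le (n + l) m z)
  have hinner := abs_le.1 (h.abs_log_sub_le n l z)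
  rw [cyl_eq_of_mem hy] at houter
  rw [cyl_eq_of_mem hx] at hinner
  rw [← Real.exp_log (h.measureReal_cyl_pos n x), ← Real.exp_log (h.measureReal_cyl_pos m y),
    ← Real.exp_log (h.measureReal_cyl_pos (n + l + m) z), ← Real.exp_add, ← Real.exp_add]
  exact Real.exp_le_exp.2 (by linarith)

theorem exists_gap_mixing [IsFiniteMeasure ν] {C : ℝ} (h : IsQuasiBernoulli X ν fun _ => C)
    (hX : WeakSpecification X) :
    ∃ (c : NNReal) (p : ℕ), c ≠ 0 ∧ ∀ n m x y, c * ν (cyl X n x) * ν (cyl X m y) ≤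
      ∑ l ∈ Finset.range (p + 1), ν (cyl X n x ∩ (sigma X)^[n + l] ⁻¹' cyl X m y) := by
  obtain ⟨p, hp⟩ := hX.exists_mem_cyl
  obtain ⟨E, hE⟩ := exists_abs_log_measureReal_cyl_le ν p
  refine ⟨(Real.exp (-E - 2 * C)).toNNReal, p,
    (Real.toNNReal_pos.2 (Real.exp_pos _)).ne', fun n m x y => ?_⟩
  obtain ⟨l, hl, z, hx, hy⟩ := hp n m x y
  have hgap : -E ≤ Real.log (ν.real (cyl X l ((sigma X)^[n] z))) :=
    (abs_le.1 (hE _)).1.trans <| Real.log_le_log (h.measureReal_cyl_pos _ _) <|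
      measureReal_mono (cyl_anti _ hl)
  calc ENNReal.ofReal (Real.exp (-E - 2 * C)) * ν (cyl X n x) * ν (cyl X m y)
      = ENNReal.ofReal (Real.exp (-E - 2 * C) * ν.real (cyl X n x) * ν.real (cyl X m y)) := by
        rw [ENNReal.ofReal_mul (by positivity), ENNReal.ofReal_mul (by positivity),
          ofReal_measureReal, ofReal_measureReal]
    _ ≤ ν (cyl X (n + l + m) z) := by
        rw [← ofReal_measureReal (μ := ν) (s := cyl X (n + l + m) z)]
        exact ENNReal.ofReal_le_ofReal (h.mul_measureReal_cyl_le hx hy hgap)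
    _ ≤ ν (cyl X n x ∩ (sigma X)^[n + l] ⁻¹' cyl X m y) :=
        measure_mono (cyl_add_subset hx (n.le_add_right l) hy)
    _ ≤ ∑ l ∈ Finset.range (p + 1), ν (cyl X n x ∩ (sigma X)^[n + l] ⁻¹' cyl X m y) :=
        Finset.single_le_sum
          (f := fun l => ν (cyl X n x ∩ (sigma X)^[n + l] ⁻¹' cyl X m y))
          (fun _ _ => zero_le) (Finset.mem_range.2 (Nat.lt_succ_of_le hl))

theorem ergodic {C : ℝ} (h : IsQuasiBernoulli X ν fun _ => C) (hν : ν ∈ invMeasures X)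
    (hX : WeakSpecification X) : Ergodic (sigma X) ν := by
  have := hν.1
  obtain ⟨c, p, hc, hmix⟩ := h.exists_gap_mixing hX
  refine (isGeneratingSequence_word X).ergodic_of_gap_mixing hν.2 hc (p := p) fun n m x y => ?_
  simpa only [← cyl_eq_cell] using hmix n m x y

end IsQuasiBernoulli

end QuasiBernoulli

theorem IsLimitPotential.integrable {k : ℕ} {X : Subshift (Fin k) ℕ} {ν : Measure X.carrier}
    {C : ℕ → ℝ} {P : ℝ} {r : X.carrier → ℝ} (hr : IsLimitPotential X ν P r)
    (h : IsQuasiBernoulli X ν C) (μ : Measure X.carrier) [IsFiniteMeasure μ] : Integrable r μ :=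
  have ⟨K, hK⟩ := h.exists_abs_le hr
  Integrable.of_bound hr.measurable.aestronglyMeasurable K (Eventually.of_forall hK)

theorem IsQuasiBernoulli.exists_limitPotential {k : ℕ} {X : Subshift (Fin k) ℕ}
    {ν : Measure X.carrier} {f : ℕ → X.carrier → ℝ} {C D : ℕ → ℝ} {P : ℝ}
    (h : IsQuasiBernoulli X ν C) (hC : Tendsto (fun n : ℕ => C n / n) atTop (𝓝 0))
    (hν : ν ∈ invMeasures X) (hr : ∀ x, rLower X ν P x = rUpper X ν P x)
    (hf : LogGibbsBounds X (fun n x => Real.log (f n x)) ν P D)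
    (hD : Tendsto (fun n : ℕ => D n / n) atTop (𝓝 0)) (hfm : ∀ n ≥ 1, Measurable (f n)) :
    ∃ r, IsLimitPotential X ν P r ∧ (∃ K, ∀ x, |r x| ≤ K) ∧ Measurable r ∧
      IntegralLimits X f ν P r ∧ IsEquilibriumFun X r ν ∧
      LogGibbsBounds X (birkhoffSum (sigma X) r) ν P C := by
  obtain ⟨r, hlim⟩ := h.exists_isLimitPotential hr
  have hG := h.logGibbsBounds hlim
  have hint (m) (hm : m ∈ invMeasures X) : Integrable r m := have := hm.1; hlim.integrable h m
  exact ⟨r, hlim, h.exists_abs_le hlim, hlim.measurable, hG.integralLimits hC hint hf hD hfm,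
    hG.isEquilibriumFun hC hν hint, hG⟩

end SymbGibbs

end

open SymbGibbs in
theorem theorem3p5_general (k : ℕ) (X : Subshift (Fin k) ℕ) (f : ℕ → X.carrier → ℝ)
    (hf : ∀ n ≥ 1, Measurable (f n) ∧ ∀ x, 0 < f n x)
    (ν : Measure X.carrier) (hν : ν ∈ invMeasures X)
    (P C₀ : ℝ) (hC₀ : 0 < C₀) (hGibbs : GibbsBounds X f ν P fun _ => C₀)
    (hr : ∀ x, rLower X ν P x = rUpper X ν P x) :
    (WeakSpecification X → AlmostAdditive X f →
      ∃ r : X.carrier → ℝ, IsLimitPotential X ν P r ∧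
        (∃ K : ℝ, ∀ x, |r x| ≤ K) ∧ Measurable r ∧
        IntegralLimits X f ν P r ∧
        (IsEquilibriumSeq X f ν ∧ ∀ μ, IsEquilibriumSeq X f μ → μ = ν) ∧
        (IsEquilibriumFun X r ν ∧ ∀ μ, IsEquilibriumFun X r μ → μ = ν) ∧
        (IsGibbs X (expBirkhoff X r) ν ∧ ∀ μ, IsGibbs X (expBirkhoff X r) μ → μ = ν)) ∧
    (WeaklyAlmostAdditive X f →
      ∃ r : X.carrier → ℝ, IsLimitPotential X ν P r ∧
        (∃ K : ℝ, ∀ x, |r x| ≤ K) ∧ Measurable r ∧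
        IntegralLimits X f ν P r ∧
        IsEquilibriumFun X r ν ∧
        IsWeakGibbs X (expBirkhoff X r) ν) := by
  have := hν.1
  have hpos (n : ℕ) (hn : n ≥ 1) := (hf n hn).2
  have hlog := hGibbs.logGibbsBounds hpos fun _ _ => hC₀
  have hquasi {C : ℕ → ℝ} (hadd : AdditiveBounds X f C) := hlog.isQuasiBernoulli
    fun n hn m hm x => hadd.abs_log_sub_le hpos hn hm x
  have hconst := tendsto_const_div_atTop_nhds_zero_nat (𝕜 := ℝ)
  constructor
  · rintro hX ⟨C, -, hadd⟩
    have hQ := hquasi hadd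
    have herg := hQ.ergodic hν hX
    obtain ⟨r, hlim, hbdd, hmeas, hint, hequi, hG⟩ := hQ.exists_limitPotential (hconst _) hν hr
      hlog (hconst _) fun n hn => (hf n hn).1
    have huniq (μ) (hμ : IsEquilibriumFun X r μ) : μ = ν :=
      hG.eq_of_isEquilibriumFun hν herg (fun m hm => have := hm.1; hlim.integrable hQ m) hμ
    exact ⟨r, hlim, hbdd, hmeas, hint,
      ⟨hint.isEquilibriumSeq_iff.2 hequi, fun μ hμ => huniq μ (hint.isEquilibriumSeq_iff.1 hμ)⟩,
      ⟨hequi, huniq⟩,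
      ⟨hν, P, _, Real.exp_pos _, hG.gibbsBounds_expBirkhoff⟩,
      fun μ hμ => hG.eq_of_isGibbs hν herg hμ⟩
  · rintro ⟨C, -, hC, hadd⟩
    have herr : Tendsto (fun n : ℕ => (|C n| + 3 * |Real.log C₀|) / n) atTop (𝓝 0) := by
      simpa [add_div, abs_div] using hC.abs.add (hconst (3 * |Real.log C₀|))
    obtain ⟨r, hlim, hbdd, hmeas, hint, hequi, hG⟩ := (hquasi hadd).exists_limitPotential herr hν
      hr hlog (hconst _) fun n hn => (hf n hn).1
    exact ⟨r, hlim, hbdd, hmeas, hint, hequi, hν, P, _, fun _ _ => Real.exp_pos _,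
      by simpa only [Real.log_exp] using herr, hG.gibbsBounds_expBirkhoff⟩

theorem theorem3p5 (k : ℕ) (X : Subshift (Fin k) ℕ) (hX : SymbGibbs.WeakSpecification X)
    (f : ℕ → X.carrier → ℝ) (hf : SymbGibbs.IsContSeq X f)
    (ν : Measure X.carrier) (hν : ν ∈ SymbGibbs.invMeasures X)
    (P C₀ : ℝ) (hC₀ : 0 < C₀) (hGibbs : SymbGibbs.GibbsBounds X f ν P (fun _ => C₀))
    (hr : ∀ x, SymbGibbs.rLower X ν P x = SymbGibbs.rUpper X ν P x) :
    (SymbGibbs.AlmostAdditive X f →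
      ∃ r : X.carrier → ℝ, SymbGibbs.IsLimitPotential X ν P r ∧
        (∃ K : ℝ, ∀ x, |r x| ≤ K) ∧ Measurable r ∧
        SymbGibbs.IntegralLimits X f ν P r ∧
        (SymbGibbs.IsEquilibriumSeq X f ν ∧
          ∀ μ, SymbGibbs.IsEquilibriumSeq X f μ → μ = ν) ∧
        (SymbGibbs.IsEquilibriumFun X r ν ∧
          ∀ μ, SymbGibbs.IsEquilibriumFun X r μ → μ = ν) ∧
        (SymbGibbs.IsGibbs X (SymbGibbs.expBirkhoff X r) ν ∧
          ∀ μ, SymbGibbs.IsGibbs X (SymbGibbs.expBirkhoff X r) μ → μ = ν)) ∧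
    (SymbGibbs.WeaklyAlmostAdditive X f →
      ∃ r : X.carrier → ℝ, SymbGibbs.IsLimitPotential X ν P r ∧
        (∃ K : ℝ, ∀ x, |r x| ≤ K) ∧ Measurable r ∧
        SymbGibbs.IntegralLimits X f ν P r ∧
        SymbGibbs.IsEquilibriumFun X r ν ∧
        SymbGibbs.IsWeakGibbs X (SymbGibbs.expBirkhoff X r) ν) :=
  have h := theorem3p5_general k X f (fun n hn => ⟨(hf n hn).1.measurable, (hf n hn).2⟩) ν hν P C₀
    hC₀ hGibbs hr
  ⟨h.1 hX, h.2⟩
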